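/- Let $k$ be a field and let $(\mathcal B,\mathbb E,\mathfrak s)$ be an extriangulated category in the sense of Nakaoka and Palu. Assume that $\mathcal B$ is $k$-linear, Hom-finite and Krull–Schmidt, has enough projectives and enough injectives, and satisfies: (WIC) for all morphisms $f:A\to B$ and $g:B\to C$ in $\mathcal B$, if $g\circ f$ is an inflation, then so is $f$; if $g\circ f$ is a deflation, then so is $g$. Let $\mathcal P$ and $\mathcal I$ be the full subcategories of projective and of injective objects. Subcategories denoted by letters below are full and closed under isomorphisms, finite direct sums (in particular they contain $0$) and direct summands. Notation. For $i\ge 0$ put $\mathbb E^{i+1}(X,Y)=\mathbb E(\Omega^iX,Y)$, where $\Omega^0X=X$ and $\Omega^{i}X$ is obtained from an $\mathbb E$-triangle $\Omega^{i}X\to P\to\Omega^{i-1}X\dashrightarrow$ with $P\in\mathcal P$ (up to isomorphism the group does not depend on the choices). For a subcategory $\mathcal C$ let $$\mathcal C^{\perp}=\{X\mid \mathbb E^i(\mathcal C,X)=0\ \forall i>0\},\qquad {}^{\perp}\mathcal C=\{X\mid \mathbb E^i(X,\mathcal C)=0\ \forall i>0\}.$$ Let $\operatorname{Cone}(\mathcal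 C,\mathcal D)$ (resp. $\operatorname{CoCone}(\mathcal C,\mathcal D)$) consist of the objects $X$ admitting an $\mathbb E$-triangle $C\to D\to X\dashrightarrow$ (resp. $X\to C\to D\dashrightarrow$) with $C\in\mathcal C$ and $D\in\mathcal D$. Put $\mathcal C^\wedge_0=\mathcal C^\vee_0=\mathcal C$, $\mathcal C^\wedge_i=\operatorname{Cone}(\mathcal C^\wedge_{i-1},\mathcal C)$ and $\mathcal C^\vee_i=\operatorname{CoCone}(\mathcal C,\mathcal C^\vee_{i-1})$ for $i>0$, $\mathcal C^\wedge=\bigcup_{i\ge0}\mathcal C^\wedge_i$ and $\mathcal C^\vee=\bigcup_{i\ge0}\mathcal C^\vee_i$. Write $\operatorname{pd}\mathcal C\le n$ (resp. $\operatorname{id}\mathcal C\le n$) if $\mathbb E^i(X,Y)=0$ (resp. $\mathbb E^i(Y,X)=0$) for all $X\in\mathcal C$, all $Y\in\mathcal B$ and all $i>n$. A pair $(\mathcal U,\mathcal V)$ of subcategories (closed under isomorphisms, finite direct sums and direct summands) is a cotorsion pair if $\mathbb E(\mathcal U,\mathcal V)=0$ and $\mathcal B=\operatorname{Cone}(\mathcal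 V,\mathcal U)=\operatorname{CoCone}(\mathcal V,\mathcal U)$. For $n\ge1$, a subcategory $\mathcal T$ is partial $n$-tilting if $\operatorname{pd}\mathcal T\le n$ and $\mathbb E^i(\mathcal T,\mathcal T)=0$ for $i=1,\dots,n$; it is $n$-tilting if moreover $\mathcal P\subseteq\mathcal T^\vee_n$. It is $n$-cotilting if $\operatorname{id}\mathcal T\le n$, $\mathbb E^i(\mathcal T,\mathcal T)=0$ for $i=1,\dots,n$, and $\mathcal I\subseteq\mathcal T^\wedge_n$. It is partial tilting (tilting, cotilting) if it is partial $n$-tilting ($n$-tilting, $n$-cotilting) for some $n\ge1$. Assume that $\mathcal B$ is Gorenstein, i.e. $\operatorname{pd}\mathcal I<\infty$ and $\operatorname{id}\mathcal P<\infty$, and that (AF) either $\mathcal B$ is an abelian category (with its usual extriangulated structure, given by the short exact sequences), or $\mathcal P$ is covariantly finite and $\mathcal I$ is contravariantly finite in $\mathcal B$. Then for every partial tilting subcategory $\mathcal T$ of $\mathcal B$ the following are equivalent: 1. $\mathcal T$ is a tilting subcategory; 2. $(\mathcal T^\vee,\mathcal T^\perp)$ is a cotorsion pair; 3. $\mathcal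 T$ is a cotilting subcategory; 4. $({}^\perp\mathcal T,\mathcal T^\wedge)$ is a cotorsion pair. In particular, every tilting subcategory $\mathcal T$ of $\mathcal B$ satisfies condition (CP): both $(\mathcal T^\vee,\mathcal T^\perp)$ and $({}^\perp\mathcal T,\mathcal T^\wedge)$ are cotorsion pairs in $\mathcal B$. -/

import Mathlib

open CategoryTheory CategoryTheory.Limits Opposite

universe w v u

namespace Extri

section Bifunctor

variable {B : Type u} [Category.{v} B]

/-- The group `𝔼(C, A)` of `𝔼`-extensions, for a bifunctor `𝔼 : Bᵒᵖ × B → Ab`. -/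
abbrev Extn (E : Bᵒᵖ ⥤ B ⥤ AddCommGrpCat.{w}) (C A : B) : Type w :=
  ((E.obj (op C)).obj A : AddCommGrpCat.{w})

/-- The push-out extension `a_* δ = 𝔼(C, a)(δ)`. -/
def push (E : Bᵒᵖ ⥤ B ⥤ AddCommGrpCat.{w}) {C A A' : B} (a : A ⟶ A') (δ : Extn E C A) :
    Extn E C A' :=
  ((E.obj (op C)).map a).hom δ

/-- The pull-back extension `c^* δ = 𝔼(c, A)(δ)`. -/
def pull (E : Bᵒᵖ ⥤ B ⥤ AddCommGrpCat.{w}) {C C' A : B} (c : C' ⟶ C) (δ : Extn E C A) :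
    Extn E C' A :=
  ((E.map c.op).app A).hom δ

/-- The direct sum `δ ⊕ δ' ∈ 𝔼(C ⊕ C', A ⊕ A')`, the element with components `(δ, 0, 0, δ')`. -/
noncomputable def sumExtn [Preadditive B] [HasZeroObject B] [HasBinaryBiproducts B]
    (E : Bᵒᵖ ⥤ B ⥤ AddCommGrpCat.{w}) {C C' A A' : B} (δ : Extn E C A) (δ' : Extn E C' A') :
    Extn E (C ⊞ C') (A ⊞ A') :=
  pull E (biprod.fst : C ⊞ C' ⟶ C) (push E (biprod.inl : A ⟶ A ⊞ A') δ) +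
    pull E (biprod.snd : C ⊞ C' ⟶ C') (push E (biprod.inr : A' ⟶ A ⊞ A') δ')

end Bifunctor

/-- An extriangulated structure `(𝔼, 𝔰)` on an additive category `B`, in the sense of
Nakaoka and Palu. The realization `𝔰` is encoded by the relation `Realizes δ x y`, which says that
the sequence `A --x--> M --y--> C` belongs to the equivalence class `𝔰(δ)`. -/
structure Structure (B : Type u) [Category.{v} B] [Preadditive B] [HasZeroObject B]
    [HasBinaryBiproducts B] where
  /-- The bifunctor `𝔼 : Bᵒᵖ × B → Ab`. -/
  E : Bᵒᵖ ⥤ B ⥤ AddCommGrpCat.{w}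
  /-- (ET1): `𝔼` is additive in the covariant variable. -/
  additive_right : ∀ C : Bᵒᵖ, (E.obj C).Additive
  /-- (ET1): `𝔼` is additive in the contravariant variable. -/
  additive_left : ∀ A : B, (E.flip.obj A).Additive
  /-- `A --x--> M --y--> C` lies in the class `𝔰(δ)`. -/
  Realizes : ∀ {A M C : B}, Extn E C A → (A ⟶ M) → (M ⟶ C) → Prop
  /-- `𝔰(δ)` is nonempty. -/
  real_exists : ∀ {A C : B} (δ : Extn E C A), ∃ (M : B) (x : A ⟶ M) (y : M ⟶ C), Realizes δ x y
  /-- Any two sequences in `𝔰(δ)` are equivalent. -/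
  real_unique : ∀ {A M M' C : B} {δ : Extn E C A} {x : A ⟶ M} {y : M ⟶ C} {x' : A ⟶ M'}
    {y' : M' ⟶ C}, Realizes δ x y → Realizes δ x' y' → ∃ b : M ≅ M', x ≫ b.hom = x' ∧ b.hom ≫ y' = y
  /-- `𝔰(δ)` is closed under equivalence. -/
  real_of_iso : ∀ {A M M' C : B} {δ : Extn E C A} {x : A ⟶ M} {y : M ⟶ C} {x' : A ⟶ M'}
    {y' : M' ⟶ C} (b : M ≅ M'), x ≫ b.hom = x' → b.hom ≫ y' = y → Realizes δ x y → Realizes δ x' y'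
  /-- `𝔰` is a realization: morphisms of extensions are realized by morphisms of sequences. -/
  real_map : ∀ {A M C A' M' C' : B} {δ : Extn E C A} {δ' : Extn E C' A'} {x : A ⟶ M}
    {y : M ⟶ C} {x' : A' ⟶ M'} {y' : M' ⟶ C'}, Realizes δ x y → Realizes δ' x' y' →
    ∀ (a : A ⟶ A') (c : C ⟶ C'), push E a δ = pull E c δ' →
      ∃ b : M ⟶ M', x ≫ b = a ≫ x' ∧ y ≫ c = b ≫ y'
  /-- (ET2): the zero extension is realized by the split sequence. -/
  real_zero : ∀ A C : B, Realizes (0 : Extn E C A) (biprod.inl : A ⟶ A ⊞ C) (biprod.snd : A ⊞ C ⟶ C)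
  /-- (ET2): `𝔰(δ ⊕ δ') = 𝔰(δ) ⊕ 𝔰(δ')`. -/
  real_sum : ∀ {A M C A' M' C' : B} {δ : Extn E C A} {δ' : Extn E C' A'} {x : A ⟶ M}
    {y : M ⟶ C} {x' : A' ⟶ M'} {y' : M' ⟶ C'}, Realizes δ x y → Realizes δ' x' y' →
    Realizes (sumExtn E δ δ') (biprod.map x x') (biprod.map y y')
  /-- (ET3). -/
  et3 : ∀ {A M C A' M' C' : B} {δ : Extn E C A} {δ' : Extn E C' A'} {x : A ⟶ M}
    {y : M ⟶ C} {x' : A' ⟶ M'} {y' : M' ⟶ C'}, Realizes δ x y → Realizes δ' x' y' →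
    ∀ (a : A ⟶ A') (b : M ⟶ M'), x ≫ b = a ≫ x' →
      ∃ c : C ⟶ C', y ≫ c = b ≫ y' ∧ push E a δ = pull E c δ'
  /-- (ET3)ᵒᵖ. -/
  et3_op : ∀ {A M C A' M' C' : B} {δ : Extn E C A} {δ' : Extn E C' A'} {x : A ⟶ M}
    {y : M ⟶ C} {x' : A' ⟶ M'} {y' : M' ⟶ C'}, Realizes δ x y → Realizes δ' x' y' →
    ∀ (b : M ⟶ M') (c : C ⟶ C'), y ≫ c = b ≫ y' →
      ∃ a : A ⟶ A', x ≫ b = a ≫ x' ∧ push E a δ = pull E c δ'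
  /-- (ET4). -/
  et4 : ∀ {A M D N F : B} {δ : Extn E D A} {δ' : Extn E F M} {f : A ⟶ M} {f' : M ⟶ D}
    {g : M ⟶ N} {g' : N ⟶ F}, Realizes δ f f' → Realizes δ' g g' →
    ∃ (Z : B) (h' : N ⟶ Z) (d : D ⟶ Z) (e : Z ⟶ F) (δ'' : Extn E Z A),
      Realizes δ'' (f ≫ g) h' ∧ f' ≫ d = g ≫ h' ∧ h' ≫ e = g' ∧
      Realizes (push E f' δ') d e ∧ pull E d δ'' = δ ∧ push E f δ'' = pull E e δ'
  /-- (ET4)ᵒᵖ. -/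
  et4_op : ∀ {D A M F C : B} {δ : Extn E M D} {δ' : Extn E C F} {f' : D ⟶ A} {f : A ⟶ M}
    {g' : F ⟶ M} {g : M ⟶ C}, Realizes δ f' f → Realizes δ' g' g →
    ∃ (Z : B) (h' : Z ⟶ A) (d : D ⟶ Z) (e : Z ⟶ F) (δ'' : Extn E C Z),
      Realizes δ'' h' (f ≫ g) ∧ d ≫ h' = f' ∧ h' ≫ f = e ≫ g' ∧
      Realizes (pull E g' δ) d e ∧ push E e δ'' = δ' ∧ push E d δ = pull E g δ''

section General

variable {B : Type u} [Category.{v} B] [Preadditive B] [HasZeroObject B] [HasBinaryBiproducts B]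

/-- The standing convention on subcategories: full (so given by a property of objects), closed
under isomorphisms, finite direct sums (including the empty one) and direct summands. -/
structure IsSubcategory (C : ObjectProperty B) : Prop where
  of_iso : ∀ {X Y : B}, (X ≅ Y) → C X → C Y
  zero : ∀ {X : B}, IsZero X → C X
  sum : ∀ {X Y : B}, C X → C Y → C (X ⊞ Y)
  summand : ∀ {X Y : B}, C (X ⊞ Y) → C X

/-- `C` is covariantly finite: every object has a left `C`-approximation. -/
def CovariantlyFinite (C : ObjectProperty B) : Prop :=
  ∀ X : B, ∃ (Y : B) (f : X ⟶ Y), C Y ∧ ∀ (Z : B) (g : X ⟶ Z), C Z → ∃ h : Y ⟶ Z, f ≫ h = g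

/-- `C` is contravariantly finite: every object has a right `C`-approximation. -/
def ContravariantlyFinite (C : ObjectProperty B) : Prop :=
  ∀ X : B, ∃ (Y : B) (f : Y ⟶ X), C Y ∧ ∀ (Z : B) (g : Z ⟶ X), C Z → ∃ h : Z ⟶ Y, h ≫ f = g

variable (B) in
/-- Every object is a finite direct sum of objects with local endomorphism rings. -/
def KrullSchmidt : Prop :=
  ∀ X : B, ∃ (n : ℕ) (Y : Fin n → B) (b : Bicone Y),
    (∀ i, IsLocalRing (End (Y i))) ∧ Nonempty b.IsBilimit ∧ Nonempty (X ≅ b.pt)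

/-- All Hom-spaces are finite-dimensional over `k`. -/
def HomFinite (k : Type*) [Field k] (B : Type u) [Category.{v} B] [Preadditive B]
    [Linear k B] : Prop :=
  ∀ X Y : B, Module.Finite k (X ⟶ Y)

end General

namespace Structure

variable {B : Type u} [Category.{v} B] [Preadditive B] [HasZeroObject B] [HasBinaryBiproducts B]
  (S : Structure.{w} B)

/-- `A --x--> M --y--> C` is (the sequence of) an `𝔼`-triangle `A → M → C ⇢`. -/
def Triangle {A M C : B} (x : A ⟶ M) (y : M ⟶ C) : Prop :=
  ∃ δ : Extn S.E C A, S.Realizes δ x y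

def Inflation {A M : B} (x : A ⟶ M) : Prop :=
  ∃ (C : B) (y : M ⟶ C), S.Triangle x y

def Deflation {M C : B} (y : M ⟶ C) : Prop :=
  ∃ (A : B) (x : A ⟶ M), S.Triangle x y

/-- The projective objects `𝓟`. -/
def proj : ObjectProperty B := fun P =>
  ∀ {A M C : B} (x : A ⟶ M) (y : M ⟶ C), S.Triangle x y → ∀ c : P ⟶ C, ∃ b : P ⟶ M, b ≫ y = c

/-- The injective objects `𝓘`. -/
def inj : ObjectProperty B := fun I =>
  ∀ {A M C : B} (x : A ⟶ M) (y : M ⟶ C), S.Triangle x y → ∀ a : A ⟶ I, ∃ b : M ⟶ I, x ≫ b = a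

def EnoughProjectives : Prop :=
  ∀ C : B, ∃ (A P : B) (x : A ⟶ P) (y : P ⟶ C), S.proj P ∧ S.Triangle x y

def EnoughInjectives : Prop :=
  ∀ A : B, ∃ (I C : B) (x : A ⟶ I) (y : I ⟶ C), S.inj I ∧ S.Triangle x y

/-- Condition (WIC). -/
def WIC : Prop :=
  (∀ {X Y Z : B} (f : X ⟶ Y) (g : Y ⟶ Z), S.Inflation (f ≫ g) → S.Inflation f) ∧
    (∀ {X Y Z : B} (f : X ⟶ Y) (g : Y ⟶ Z), S.Deflation (f ≫ g) → S.Deflation g)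

/-- `Cone(C, D)`: objects `X` with an `𝔼`-triangle `C → D → X ⇢`. -/
def Cone (C D : ObjectProperty B) : ObjectProperty B := fun X =>
  ∃ (U V : B) (x : U ⟶ V) (y : V ⟶ X), C U ∧ D V ∧ S.Triangle x y

/-- `CoCone(C, D)`: objects `X` with an `𝔼`-triangle `X → C → D ⇢`. -/
def CoCone (C D : ObjectProperty B) : ObjectProperty B := fun X =>
  ∃ (U V : B) (x : X ⟶ U) (y : U ⟶ V), C U ∧ D V ∧ S.Triangle x y

/-- `C^∧_n`. -/
def wedgeN (C : ObjectProperty B) : ℕ → ObjectProperty B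
  | 0 => C
  | n + 1 => S.Cone (wedgeN C n) C

/-- `C^∨_n`. -/
def veeN (C : ObjectProperty B) : ℕ → ObjectProperty B
  | 0 => C
  | n + 1 => S.CoCone C (veeN C n)

/-- `C^∧`. -/
def wedge (C : ObjectProperty B) : ObjectProperty B := fun X => ∃ n, S.wedgeN C n X

/-- `C^∨`. -/
def vee (C : ObjectProperty B) : ObjectProperty B := fun X => ∃ n, S.veeN C n X

/-- `S.IsSyzygy n X Z`: the object `Z` is an `n`-th syzygy `Ωⁿ X` of `X` (for some choice of the
successive `𝔼`-triangles `Ω Y → P → Y ⇢` with `P` projective). -/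
def IsSyzygy : ℕ → B → B → Prop
  | 0, X, Z => Z = X
  | n + 1, X, Z => ∃ (Y P : B) (x : Z ⟶ P) (y : P ⟶ Y),
      IsSyzygy n X Y ∧ S.proj P ∧ S.Triangle x y

/-- `S.ExtVanish n X Y` says `𝔼^{n+1}(X, Y) = 0`, where `𝔼^{n+1}(X, Y) = 𝔼(Ωⁿ X, Y)`.
For `n = 0` it says `𝔼(X, Y) = 0`. As the group does not depend on the choice of `Ωⁿ X`, which
exists when there are enough projectives, vanishing is required for every choice. -/
def ExtVanish (n : ℕ) (X Y : B) : Prop :=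
  ∀ Z : B, S.IsSyzygy n X Z → ∀ δ : Extn S.E Z Y, δ = 0

/-- `C^⊥`: objects `X` with `𝔼^i(C, X) = 0` for all `i > 0`. -/
def rightPerp (C : ObjectProperty B) : ObjectProperty B := fun X =>
  ∀ Y, C Y → ∀ n : ℕ, S.ExtVanish n Y X

/-- `^⊥C`: objects `X` with `𝔼^i(X, C) = 0` for all `i > 0`. -/
def leftPerp (C : ObjectProperty B) : ObjectProperty B := fun X =>
  ∀ Y, C Y → ∀ n : ℕ, S.ExtVanish n X Y

/-- `(U, V)` is a (complete) cotorsion pair. -/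
structure IsCotorsionPair (U V : ObjectProperty B) : Prop where
  left : IsSubcategory U
  right : IsSubcategory V
  ext_eq_zero : ∀ X Y : B, U X → V Y → ∀ δ : Extn S.E X Y, δ = 0
  cone : ∀ X : B, S.Cone V U X
  cocone : ∀ X : B, S.CoCone V U X

/-- `pd C ≤ n`: `𝔼^i(X, -) = 0` for all `X ∈ C` and `i > n`. -/
def PdLE (C : ObjectProperty B) (n : ℕ) : Prop :=
  ∀ X, C X → ∀ (Y : B) (i : ℕ), n ≤ i → S.ExtVanish i X Y

/-- `id C ≤ n`: `𝔼^i(-, X) = 0` for all `X ∈ C` and `i > n`. -/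
def IdLE (C : ObjectProperty B) (n : ℕ) : Prop :=
  ∀ X, C X → ∀ (Y : B) (i : ℕ), n ≤ i → S.ExtVanish i Y X

/-- Partial `n`-tilting subcategories. -/
structure IsPartialTiltingN (n : ℕ) (T : ObjectProperty B) : Prop where
  one_le : 1 ≤ n
  subcategory : IsSubcategory T
  /-- `pd T ≤ n`. -/
  pd_le : S.PdLE T n
  /-- `𝔼^i(T, T) = 0` for `i = 1, …, n`. -/
  ext_eq_zero : ∀ X Y : B, T X → T Y → ∀ i < n, S.ExtVanish i X Y

/-- `n`-tilting subcategories: partial `n`-tilting with `𝓟 ⊆ T^∨_n`. -/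
def IsTiltingN (n : ℕ) (T : ObjectProperty B) : Prop :=
  S.IsPartialTiltingN n T ∧ S.proj ≤ S.veeN T n

/-- Partial `n`-cotilting subcategories (the dual notion). -/
structure IsPartialCotiltingN (n : ℕ) (T : ObjectProperty B) : Prop where
  one_le : 1 ≤ n
  subcategory : IsSubcategory T
  id_le : S.IdLE T n
  ext_eq_zero : ∀ X Y : B, T X → T Y → ∀ i < n, S.ExtVanish i X Y

/-- `n`-cotilting subcategories: partial `n`-cotilting with `𝓘 ⊆ T^∧_n`. -/
def IsCotiltingN (n : ℕ) (T : ObjectProperty B) : Prop :=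
  S.IsPartialCotiltingN n T ∧ S.inj ≤ S.wedgeN T n

def IsPartialTilting (T : ObjectProperty B) : Prop := ∃ n, S.IsPartialTiltingN n T

def IsTilting (T : ObjectProperty B) : Prop := ∃ n, S.IsTiltingN n T

def IsCotilting (T : ObjectProperty B) : Prop := ∃ n, S.IsCotiltingN n T

/-- `B` is Gorenstein: `pd 𝓘 < ∞` and `id 𝓟 < ∞`. -/
def IsGorenstein : Prop := (∃ n, S.PdLE S.inj n) ∧ (∃ n, S.IdLE S.proj n)

/-- `B` is an abelian category with its usual extriangulated structure, i.e. the sequences of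
`𝔼`-triangles are exactly the short exact sequences. -/
def IsAbelian : Prop :=
  (∃ h : Abelian B, h.toPreadditive = (inferInstance : Preadditive B)) ∧
    ∀ {A M C : B} (x : A ⟶ M) (y : M ⟶ C),
      S.Triangle x y ↔ ∃ hxy : x ≫ y = 0, (ShortComplex.mk x y hxy).ShortExact

/-- Condition (AF). -/
def AF : Prop :=
  S.IsAbelian ∨ (CovariantlyFinite S.proj ∧ ContravariantlyFinite S.inj)

/-- Condition (CP): `(W^∨, W^⊥)` and `(^⊥W, W^∧)` are cotorsion pairs. -/
def CP (W : ObjectProperty B) : Prop :=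
  S.IsCotorsionPair (S.vee W) (S.rightPerp W) ∧ S.IsCotorsionPair (S.leftPerp W) (S.wedge W)

end Structure

end Extri

/-! ### Functoriality of extensions. -/

namespace Extri

section Bifunctor

variable {B : Type u} [Category.{v} B] (E : Bᵒᵖ ⥤ B ⥤ AddCommGrpCat.{w})

/-! Everything rests on one property of `T`, called `Generates`: each `X ∈ T^⊥` has a triangle `K →
U → X` with `U ∈ T` and `K ∈ T^⊥`. Since `T` has finite projective dimension, dimension shifting
along injectives and Salce's trick then make `(T^∨, T^⊥)` a cotorsion pair (`Generates.cotorsion`).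
Conversely, such a pair coresolves projectives by `T`, in length bounded by `pd T`
(`PreTilting.isProj_veeN`).

To obtain `Generates` for a tilting `T` in a Gorenstein category (`PreTilting.generates`), the
injectives are treated first. Any `X` embeds in a high cosyzygy with cokernel of finite injective
dimension; for `X ∈ 𝓘^⊥` this splits, so `X` is a quotient of an injective with kernel in `𝓘^⊥`
(`Gorenstein.generates_isInj`). Hence `(𝓘^∨, 𝓘^⊥)` is a cotorsion pair. For `X ∈ T^⊥`, approximate
it by `J → Z → X` with `J ∈ 𝓘^⊥` and `Z ∈ 𝓘^∨`. Objects of `T` have finite injective dimension, so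
`J`, and then `Z`, lies in `T^⊥`; moreover `Z` has finite projective dimension. An
Auslander–Buchweitz triangle `Z → Y → W` with `Y ∈ T^∧`, `W ∈ T^∨` therefore splits, and the cover
of `Y` by `T` induces one of `X`.

The resulting covers resolve injectives by `T` in length at most `d`, so tilting implies cotilting.
The argument uses only triangles up to isomorphism and vanishing of extensions. These satisfy the
self-dual axioms `ExactRel`, so the cotilting half is the same proof applied to `R.dual`. -/

@[simp] lemma push_zero {C A A' : B} (a : A ⟶ A') : push E a (0 : Extn E C A) = 0 :=
  map_zero ((E.obj (op C)).map a).hom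

@[simp] lemma pull_zero {C C' A : B} (c : C' ⟶ C) : pull E c (0 : Extn E C A) = 0 :=
  map_zero ((E.map c.op).app A).hom

lemma push_sub {C A A' : B} (a : A ⟶ A') (δ δ' : Extn E C A) :
    push E a (δ - δ') = push E a δ - push E a δ' :=
  map_sub ((E.obj (op C)).map a).hom δ δ'

lemma pull_sub {C C' A : B} (c : C' ⟶ C) (δ δ' : Extn E C A) :
    pull E c (δ - δ') = pull E c δ - pull E c δ' :=
  map_sub ((E.map c.op).app A).hom δ δ'

@[simp] lemma push_id {C A : B} (δ : Extn E C A) : push E (𝟙 A) δ = δ := by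
  simp [push]

@[simp] lemma pull_id {C A : B} (δ : Extn E C A) : pull E (𝟙 C) δ = δ := by
  simp [pull]

lemma push_comp {C A A' A'' : B} (a : A ⟶ A') (a' : A' ⟶ A'') (δ : Extn E C A) :
    push E (a ≫ a') δ = push E a' (push E a δ) := by
  simp [push]

lemma pull_comp {C C' C'' A : B} (c : C' ⟶ C) (c' : C'' ⟶ C') (δ : Extn E C A) :
    pull E (c' ≫ c) δ = pull E c' (pull E c δ) := by
  simp [pull]

lemma push_pull {C C' A A' : B} (a : A ⟶ A') (c : C' ⟶ C) (δ : Extn E C A) :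
    push E a (pull E c δ) = pull E c (push E a δ) := by
  simp [push, pull]

end Bifunctor

namespace Structure

variable {B : Type u} [Category.{v} B] [Preadditive B] [HasZeroObject B] [HasBinaryBiproducts B]
  (S : Structure.{w} B)

lemma push_add_left {C A A' : B} (a a' : A ⟶ A') (δ : Extn S.E C A) :
    push S.E (a + a') δ = push S.E a δ + push S.E a' δ := by
  have := S.additive_right (op C)
  simp [push, Functor.map_add]

lemma pull_add_left {C C' A : B} (c c' : C' ⟶ C) (δ : Extn S.E C A) :
    pull S.E (c + c') δ = pull S.E c δ + pull S.E c' δ := by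
  have := S.additive_left A
  have h : (S.E.flip.obj A).map (c + c').op
      = (S.E.flip.obj A).map c.op + (S.E.flip.obj A).map c'.op := by
    rw [← Functor.map_add]; rfl
  exact congr_arg (fun f => f.hom δ) h

@[simp] lemma push_zero_left {C A A' : B} (δ : Extn S.E C A) :
    push S.E (0 : A ⟶ A') δ = 0 := by
  simpa using S.push_add_left (0 : A ⟶ A') 0 δ

@[simp] lemma pull_zero_left {C C' A : B} (δ : Extn S.E C A) :
    pull S.E (0 : C' ⟶ C) δ = 0 := by
  simpa using S.pull_add_left (0 : C' ⟶ C) 0 δ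

variable {S}

/-! ### Exact sequences attached to a triangle. -/

section Exactness

variable {A M C : B} {δ : Extn S.E C A} {x : A ⟶ M} {y : M ⟶ C}

lemma realizes_zero_id (S : Structure.{w} B) {Z : B} (hZ : IsZero Z) (M : B) :
    S.Realizes (0 : Extn S.E M Z) (0 : Z ⟶ M) (𝟙 M) := by
  refine S.real_of_iso (x := biprod.inl) (y := biprod.snd)
    ⟨biprod.snd, biprod.inr, ?_, by simp⟩ (by simp) (by simp) (S.real_zero Z M)
  ext
  · exact hZ.eq_of_tgt _ _
  · simp
  · exact hZ.eq_of_tgt _ _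
  · simp

lemma realizes_id_zero (S : Structure.{w} B) {Z : B} (hZ : IsZero Z) (M : B) :
    S.Realizes (0 : Extn S.E Z M) (𝟙 M) (0 : M ⟶ Z) := by
  refine S.real_of_iso (x := biprod.inl) (y := biprod.snd)
    ⟨biprod.fst, biprod.inl, ?_, by simp⟩ (by simp) (hZ.eq_of_tgt _ _) (S.real_zero M Z)
  ext
  · simp
  · exact hZ.eq_of_tgt _ _
  · exact hZ.eq_of_src _ _
  · exact hZ.eq_of_tgt _ _

/-- Compare with the trivial triangle `0 → M → M`, whose extension is zero. -/
lemma Realizes.pull_eq_zero (h : S.Realizes δ x y) : pull S.E y δ = 0 := by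
  obtain ⟨a, -, ha⟩ := S.et3_op (S.realizes_zero_id (isZero_zero B) M) h (𝟙 M) y (by simp)
  simpa using ha.symm

lemma Realizes.push_eq_zero (h : S.Realizes δ x y) : push S.E x δ = 0 := by
  obtain ⟨c, -, hc⟩ := S.et3 h (S.realizes_id_zero (isZero_zero B) M) x (𝟙 M) (by simp)
  simpa using hc

lemma Realizes.exists_lift (h : S.Realizes δ x y) {X : B} (c : X ⟶ C) (hc : pull S.E c δ = 0) :
    ∃ b : X ⟶ M, b ≫ y = c := by
  obtain ⟨b, -, hb⟩ := S.real_map (S.real_zero A X) h (𝟙 A) c (by simp [hc])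
  exact ⟨biprod.inr ≫ b, by rw [Category.assoc, ← hb]; simp⟩

lemma Realizes.exists_desc (h : S.Realizes δ x y) {X : B} (a : A ⟶ X) (ha : push S.E a δ = 0) :
    ∃ b : M ⟶ X, x ≫ b = a := by
  obtain ⟨b, hb, -⟩ := S.real_map h (S.real_zero X C) a (𝟙 C) (by simp [ha])
  exact ⟨b ≫ biprod.fst, by rw [← Category.assoc, hb]; simp⟩

lemma Realizes.exists_pull (h : S.Realizes δ x y) {X : B} (η : Extn S.E X A)
    (hη : push S.E x η = 0) : ∃ c : X ⟶ C, η = pull S.E c δ := by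
  obtain ⟨N, u, v, hN⟩ := S.real_exists η
  obtain ⟨b, hb⟩ := hN.exists_desc x hη
  obtain ⟨c, -, hc⟩ := S.et3 hN h (𝟙 A) b (by simp [hb])
  exact ⟨c, by simpa using hc⟩

lemma Realizes.exists_push (h : S.Realizes δ x y) {X : B} (η : Extn S.E C X)
    (hη : pull S.E y η = 0) : ∃ a : A ⟶ X, η = push S.E a δ := by
  obtain ⟨N, u, v, hN⟩ := S.real_exists η
  obtain ⟨b, hb⟩ := hN.exists_lift y hη
  obtain ⟨a, -, ha⟩ := S.et3_op h hN b (𝟙 C) (by simp [hb])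
  exact ⟨a, by simpa using ha.symm⟩

/-- (ET4) realizes `y_* θ` by a deflation `e` with `e^* θ = x_* δ''`. When `y_* θ` vanishes, `e` has
a section, and pulling back along it exhibits `θ` in the image of `x_*`. -/
lemma Realizes.exists_push_fst (h : S.Realizes δ x y) {X : B} (θ : Extn S.E X M)
    (hθ : push S.E y θ = 0) : ∃ θ' : Extn S.E X A, θ = push S.E x θ' := by
  obtain ⟨N, g, g', hN⟩ := S.real_exists θ
  obtain ⟨Z, h', d, e, δ'', -, -, -, hde, -, hp⟩ := S.et4 h hN
  obtain ⟨s, hs⟩ := hde.exists_lift (𝟙 X) (by simpa using hθ)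
  exact ⟨pull S.E s δ'', by rw [push_pull, hp, ← pull_comp, hs, pull_id]⟩

lemma Realizes.exists_pull_snd (h : S.Realizes δ x y) {X : B} (θ : Extn S.E M X)
    (hθ : pull S.E x θ = 0) : ∃ θ' : Extn S.E C X, θ = pull S.E y θ' := by
  obtain ⟨N, g, g', hN⟩ := S.real_exists θ
  obtain ⟨Z, h', d, e, δ'', -, -, -, hde, -, hp⟩ := S.et4_op hN h
  obtain ⟨s, hs⟩ := hde.exists_desc (𝟙 X) (by simpa using hθ)
  exact ⟨push S.E s δ'', by rw [← push_pull, ← hp, ← push_comp, hs, push_id]⟩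

lemma Realizes.comp_eq_zero (h : S.Realizes δ x y) : x ≫ y = 0 := by
  obtain ⟨c, hc, -⟩ := S.et3 (S.realizes_id_zero (isZero_zero B) A) h (𝟙 A) x (by simp)
  rw [← hc, zero_comp]

lemma realizes_of_split (S : Structure.{w} B) {A M C : B} (x : A ⟶ M) (y : M ⟶ C) (r : M ⟶ A)
    (s : C ⟶ M) (hx : x ≫ r = 𝟙 A) (hy : s ≫ y = 𝟙 C) (hxy : x ≫ y = 0) (hsr : s ≫ r = 0)
    (ht : r ≫ x + y ≫ s = 𝟙 M) : S.Realizes (0 : Extn S.E C A) x y := by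
  refine S.real_of_iso (x := biprod.inl) (y := biprod.snd)
    ⟨biprod.desc x s, biprod.lift r y, ?_, by simpa using ht⟩ (by simp) ?_ (S.real_zero A C)
  · ext <;> simp [hx, hy, hxy, hsr]
  · ext <;> simp [hy, hxy]

/-- An extension that is zero has a middle term isomorphic to the biproduct. -/
lemma Realizes.exists_iso (h : S.Realizes δ x y) (hδ : δ = 0) :
    ∃ b : M ≅ A ⊞ C, x ≫ b.hom = biprod.inl ∧ b.hom ≫ biprod.snd = y := by
  subst hδ
  exact S.real_unique h (S.real_zero A C)

end Exactness

lemma Realizes.exists_factor {A M C : B} {δ : Extn S.E C A} {x : A ⟶ M} {y : M ⟶ C}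
    (h : S.Realizes δ x y) {X : B} (g : X ⟶ M) (hg : g ≫ y = 0) : ∃ a : X ⟶ A, a ≫ x = g := by
  obtain ⟨a, ha, -⟩ := S.et3_op (S.realizes_id_zero (isZero_zero B) X) h g 0 (by simp [hg])
  exact ⟨a, by simpa using ha.symm⟩

/-- The difference `b - 𝟙` factors through `x` and is killed by precomposition with `x`, so it
squares to zero; the inverse of `b` is `2 - b`. -/
lemma Realizes.isIso_of_comp {A M C : B} {δ : Extn S.E C A} {x : A ⟶ M} {y : M ⟶ C}
    (h : S.Realizes δ x y) (b : M ⟶ M) (hx : x ≫ b = x) (hy : b ≫ y = y) : IsIso b := by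
  obtain ⟨s, hs⟩ := h.exists_factor (b - 𝟙 M) (by simp [Preadditive.sub_comp, hy])
  have hn : (b - 𝟙 M) ≫ (b - 𝟙 M) = 0 := by
    nth_rw 1 [← hs]
    simp [Preadditive.comp_sub, hx]
  have hbb : b ≫ b = b + b - 𝟙 M := by
    simp only [Preadditive.comp_sub, Preadditive.sub_comp, Category.comp_id,
      Category.id_comp] at hn
    rw [← sub_eq_zero, ← hn]; abel
  refine ⟨𝟙 M + 𝟙 M - b, ?_, ?_⟩
  · simp only [Preadditive.comp_sub, Preadditive.comp_add, Category.comp_id, hbb]; abel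
  · simp only [Preadditive.sub_comp, Preadditive.add_comp, Category.id_comp, hbb]; abel

/-- The axioms allow only the middle term to be changed by an isomorphism. For the end terms,
comparison maps are taken in both directions; their composites fix the ends, hence are invertible.
-/
lemma Realizes.iso {A M C A' C' : B} {δ : Extn S.E C A} {x : A ⟶ M} {y : M ⟶ C}
    (h : S.Realizes δ x y) (a : A ≅ A') (c : C ≅ C') :
    S.Realizes (push S.E a.hom (pull S.E c.inv δ)) (a.inv ≫ x) (y ≫ c.hom) := by
  obtain ⟨N, u, v, hN⟩ := S.real_exists (push S.E a.hom (pull S.E c.inv δ))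
  obtain ⟨b, hb₁, hb₂⟩ := S.real_map h hN a.hom c.hom (by
    rw [← push_pull, ← pull_comp, c.hom_inv_id, pull_id])
  obtain ⟨b', hb₁', hb₂'⟩ := S.real_map hN h a.inv c.inv (by
    rw [← push_comp, a.hom_inv_id, push_id])
  have h₁ : IsIso (b ≫ b') := h.isIso_of_comp _
    (by rw [reassoc_of% hb₁, hb₁', a.hom_inv_id_assoc])
    (by rw [Category.assoc, ← hb₂', ← reassoc_of% hb₂, c.hom_inv_id, Category.comp_id])
  have h₂ : IsIso (b' ≫ b) := hN.isIso_of_comp _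
    (by rw [reassoc_of% hb₁', hb₁, a.inv_hom_id_assoc])
    (by rw [Category.assoc, ← hb₂, ← reassoc_of% hb₂', c.inv_hom_id, Category.comp_id])
  have hb : IsIso b := by
    have : IsSplitMono b := ⟨⟨b' ≫ inv (b ≫ b'), by rw [← Category.assoc, IsIso.hom_inv_id]⟩⟩
    have : Epi b := by
      have : Epi (b' ≫ b) := inferInstance
      exact epi_of_epi b' b
    exact isIso_of_epi_of_isSplitMono b
  refine S.real_of_iso (asIso b).symm ?_ ?_ hN
  · simp [IsIso.comp_inv_eq, hb₁]
  · simp [hb₂]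

/-- There is an `𝔼`-triangle `A → M → C ⇢`. -/
def Tr (S : Structure.{w} B) (A M C : B) : Prop := ∃ (x : A ⟶ M) (y : M ⟶ C), S.Triangle x y

lemma Realizes.tr {A M C : B} {δ : Extn S.E C A} {x : A ⟶ M} {y : M ⟶ C}
    (h : S.Realizes δ x y) : S.Tr A M C := ⟨x, y, δ, h⟩

lemma Tr.iso {A M C A' M' C' : B} (a : A ≅ A') (m : M ≅ M') (c : C ≅ C') (h : S.Tr A M C) :
    S.Tr A' M' C' := by
  obtain ⟨x, y, δ, h⟩ := h
  exact (S.real_of_iso (x' := a.inv ≫ x ≫ m.hom) (y' := m.inv ≫ y ≫ c.hom) m (by simp)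
    (by simp) (h.iso a c)).tr

/-- Pull-back of two `𝔼`-triangles with a common third term. -/
lemma Realizes.exists_pullback {A₁ M₁ A₂ M₂ C : B} {δ₁ : Extn S.E C A₁} {δ₂ : Extn S.E C A₂}
    {x₁ : A₁ ⟶ M₁} {y₁ : M₁ ⟶ C} {x₂ : A₂ ⟶ M₂} {y₂ : M₂ ⟶ C}
    (h₁ : S.Realizes δ₁ x₁ y₁) (h₂ : S.Realizes δ₂ x₂ y₂) :
    ∃ W, S.Tr A₁ W M₂ ∧ S.Tr A₂ W M₁ := by
  obtain ⟨W, f₂, g₁, hW⟩ := S.real_exists (pull S.E y₁ δ₂)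
  obtain ⟨Z, h', d, e, δ'', hZ, hd, he, hde, hpush, hpull⟩ := S.et4_op hW h₁
  have h0 : pull S.E x₁ (pull S.E y₁ δ₂) = 0 := by
    rw [← pull_comp, h₁.comp_eq_zero, pull_zero_left]
  rw [h0] at hde
  obtain ⟨b, hb₁, hb₂⟩ := hde.exists_iso rfl
  have hp : d ≫ b.hom ≫ biprod.fst = 𝟙 A₂ := by rw [← Category.assoc, hb₁]; simp
  -- The retraction of `d` given by the splitting sends `δ''` to `δ₂` only up to a class `a_* δ₁`.
  -- Adding `e ≫ a` to it removes the error, and (ET4) for the corrected splitting gives the second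
  -- triangle.
  have hdiff : pull S.E y₁ (δ₂ - push S.E (b.hom ≫ biprod.fst) δ'') = 0 := by
    rw [pull_sub, ← push_pull, ← hpull, ← push_comp, hp, push_id, sub_self]
  obtain ⟨a, ha⟩ := h₁.exists_push _ hdiff
  have hde0 : d ≫ e = 0 := hde.comp_eq_zero
  have hp' : push S.E (b.hom ≫ biprod.fst + e ≫ a) δ'' = δ₂ := by
    rw [push_add_left, push_comp _ e a, hpush, ← ha]; abel
  have hb₃ : b.inv ≫ e = biprod.snd := by rw [← hb₂]; simp
  have hsplit : S.Realizes (0 : Extn S.E A₂ A₁) ((biprod.inr - a ≫ biprod.inl) ≫ b.inv)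
      (b.hom ≫ biprod.fst + e ≫ a) := by
    refine S.realizes_of_split _ _ e d ?_ ?_ ?_ hde0 ?_
    · simp [hb₃]
    · rw [Preadditive.comp_add, hp, ← Category.assoc, hde0]; simp
    · simp [reassoc_of% hb₃]
    · rw [← cancel_epi b.inv, ← cancel_mono b.hom]
      simp only [Preadditive.add_comp, Preadditive.comp_add, Preadditive.sub_comp,
        Preadditive.comp_sub, Category.assoc, Iso.inv_hom_id, Category.comp_id, hb₁,
        Iso.inv_hom_id_assoc, reassoc_of% hb₃]
      rw [← biprod.total]; abel
  obtain ⟨Z', k, p, q, ε, hk, -, -, hpq, -, -⟩ := S.et4 hsplit hZ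
  rw [hp'] at hpq
  obtain ⟨i, -, -⟩ := S.real_unique hpq h₂
  exact ⟨W, hk.tr.iso (Iso.refl _) (Iso.refl _) i, hW.tr⟩

/-- Push-out of two `𝔼`-triangles with a common first term. -/
lemma Realizes.exists_pushout {A M₁ C₁ M₂ C₂ : B} {δ₁ : Extn S.E C₁ A} {δ₂ : Extn S.E C₂ A}
    {x₁ : A ⟶ M₁} {y₁ : M₁ ⟶ C₁} {x₂ : A ⟶ M₂} {y₂ : M₂ ⟶ C₂}
    (h₁ : S.Realizes δ₁ x₁ y₁) (h₂ : S.Realizes δ₂ x₂ y₂) :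
    ∃ W, S.Tr M₂ W C₁ ∧ S.Tr M₁ W C₂ := by
  obtain ⟨W, f, g, hW⟩ := S.real_exists (push S.E x₁ δ₂)
  obtain ⟨Z, h', d, e, δ'', hZ, hd, he, hde, hpull, hpush⟩ := S.et4 h₁ hW
  have h0 : push S.E y₁ (push S.E x₁ δ₂) = 0 := by
    rw [← push_comp, h₁.comp_eq_zero, push_zero_left]
  rw [h0] at hde
  obtain ⟨b, hb₁, hb₂⟩ := hde.exists_iso rfl
  have hb₃ : b.inv ≫ e = biprod.snd := by rw [← hb₂]; simp
  have hp : (biprod.inr ≫ b.inv) ≫ e = 𝟙 C₂ := by rw [Category.assoc, hb₃]; simp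
  -- Dually, the section of `e` is corrected by `c ≫ d` so that `δ''` pulls back to `δ₂` exactly.
  have hdiff : push S.E x₁ (δ₂ - pull S.E (biprod.inr ≫ b.inv) δ'') = 0 := by
    rw [push_sub, push_pull, hpush, ← pull_comp, hp, pull_id, sub_self]
  obtain ⟨c, hc⟩ := h₁.exists_pull _ hdiff
  have hde0 : d ≫ e = 0 := hde.comp_eq_zero
  have hp' : pull S.E (biprod.inr ≫ b.inv + c ≫ d) δ'' = δ₂ := by
    rw [pull_add_left, pull_comp _ d c, hpull, ← hc]; abel
  have hsplit : S.Realizes (0 : Extn S.E C₁ C₂) (biprod.inr ≫ b.inv + c ≫ d)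
      (b.hom ≫ (biprod.fst - biprod.snd ≫ c)) := by
    refine S.realizes_of_split _ _ e d ?_ ?_ ?_ hde0 ?_
    · simp only [Preadditive.add_comp, hp, Category.assoc, hde0]; simp
    · simp [reassoc_of% hb₁]
    · simp [reassoc_of% hb₁]
    · rw [← cancel_epi b.inv, ← cancel_mono b.hom]
      simp only [Preadditive.add_comp, Preadditive.comp_add, Preadditive.sub_comp,
        Preadditive.comp_sub, Category.assoc, Iso.inv_hom_id, Category.comp_id, hb₁,
        Iso.inv_hom_id_assoc, reassoc_of% hb₃]
      rw [← biprod.total]; abel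
  obtain ⟨Z', k, p, q, ε, hk, -, -, hpq, -, -⟩ := S.et4_op hZ hsplit
  rw [hp'] at hpq
  obtain ⟨i, -, -⟩ := S.real_unique hpq h₂
  exact ⟨W, hk.tr.iso i (Iso.refl _) (Iso.refl _), hW.tr⟩

end Structure

/-- The objects of an extriangulated category with enough projectives and injectives, with the
relations `Tr A M C` (there is an `𝔼`-triangle `A → M → C ⇢`) and `V n X Y`
(`𝔼^{n+1}(X, Y) = 0`), and the properties of these relations needed for tilting theory. The list of
properties is self-dual, and duality does not change the objects. -/
structure ExactRel (B : Type u) [Category.{v} B] [Preadditive B] [HasZeroObject B]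
    [HasBinaryBiproducts B] where
  Tr : B → B → B → Prop
  V : ℕ → B → B → Prop
  tr_iso : ∀ {A M C A' M' C' : B}, (A ≅ A') → (M ≅ M') → (C ≅ C') → Tr A M C → Tr A' M' C'
  tr_biprod : ∀ A C : B, Tr A (A ⊞ C) C
  split : ∀ {A M C : B}, Tr A M C → V 0 C A → Nonempty (M ≅ A ⊞ C)
  et4 : ∀ {A M D N F : B}, Tr A M D → Tr M N F → ∃ Z, Tr A N Z ∧ Tr D Z F
  et4_op : ∀ {D A M F C : B}, Tr D A M → Tr F M C → ∃ Z, Tr Z A C ∧ Tr D Z F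
  pushout : ∀ {A M C M' C' : B}, Tr A M C → Tr A M' C' → ∃ W, Tr M' W C ∧ Tr M W C'
  pullback : ∀ {A M C A' M' : B}, Tr A M C → Tr A' M' C → ∃ W, Tr A W M' ∧ Tr A' W M
  left_mid : ∀ {A M C Y : B} {n : ℕ}, Tr A M C → V n A Y → V n C Y → V n M Y
  left_fst : ∀ {A M C Y : B} {n : ℕ}, Tr A M C → V n M Y → V (n + 1) C Y → V n A Y
  left_snd : ∀ {A M C Y : B} {n : ℕ}, Tr A M C → V n A Y → V (n + 1) M Y → V (n + 1) C Y
  right_mid : ∀ {A M C X : B} {n : ℕ}, Tr A M C → V n X A → V n X C → V n X M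
  right_fst : ∀ {A M C X : B} {n : ℕ}, Tr A M C → V n X C → V (n + 1) X M → V (n + 1) X A
  right_snd : ∀ {A M C X : B} {n : ℕ}, Tr A M C → V n X M → V (n + 1) X A → V n X C
  left_summand : ∀ {X X' Y : B} {n : ℕ}, V n (X ⊞ X') Y → V n X Y
  right_summand : ∀ {X X' Y : B} {n : ℕ}, V n Y (X ⊞ X') → V n Y X
  enough_proj : ∀ X : B, ∃ K P, Tr K P X ∧ ∀ n Y, V n P Y
  enough_inj : ∀ X : B, ∃ I K, Tr X I K ∧ ∀ n Y, V n Y I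

/-! ### Tilting theory from the self-dual axioms. -/

namespace ExactRel

open ZeroObject

variable {B : Type u} [Category.{v} B] [Preadditive B] [HasZeroObject B] [HasBinaryBiproducts B]

/-- The relations of the opposite category. -/
def dual (R : ExactRel B) : ExactRel B where
  Tr A M C := R.Tr C M A
  V n X Y := R.V n Y X
  tr_iso a m c h := R.tr_iso c m a h
  tr_biprod A C := R.tr_iso (Iso.refl _) (biprod.braiding C A) (Iso.refl _) (R.tr_biprod C A)
  split h hV := ⟨(R.split h hV).some ≪≫ biprod.braiding _ _⟩
  et4 h h' := R.et4_op h' h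
  et4_op h h' := R.et4 h' h
  pushout h h' := by
    obtain ⟨W, h₁, h₂⟩ := R.pullback h h'
    exact ⟨W, h₁, h₂⟩
  pullback h h' := by
    obtain ⟨W, h₁, h₂⟩ := R.pushout h h'
    exact ⟨W, h₁, h₂⟩
  left_mid h h₁ h₂ := R.right_mid h h₂ h₁
  left_fst h h₁ h₂ := R.right_snd h h₁ h₂
  left_snd h h₁ h₂ := R.right_fst h h₁ h₂
  right_mid h h₁ h₂ := R.left_mid h h₂ h₁
  right_fst h h₁ h₂ := R.left_snd h h₁ h₂
  right_snd h h₁ h₂ := R.left_fst h h₁ h₂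
  left_summand h := R.right_summand h
  right_summand h := R.left_summand h
  enough_proj X := by
    obtain ⟨I, K, h, hI⟩ := R.enough_inj X
    exact ⟨K, I, h, hI⟩
  enough_inj X := by
    obtain ⟨K, P, h, hP⟩ := R.enough_proj X
    exact ⟨P, K, h, hP⟩

variable (R : ExactRel B)

def IsProj (P : B) : Prop := ∀ n Y, R.V n P Y

def IsInj (I : B) : Prop := ∀ n Y, R.V n Y I

/-- `C^∨_n`. -/
def veeN (T : ObjectProperty B) : ℕ → ObjectProperty B
  | 0 => T
  | n + 1 => fun X => ∃ U W, T U ∧ veeN T n W ∧ R.Tr X U W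

def vee (T : ObjectProperty B) : ObjectProperty B := fun X => ∃ n, R.veeN T n X

def wedgeN (T : ObjectProperty B) (n : ℕ) : ObjectProperty B := R.dual.veeN T n

def wedge (T : ObjectProperty B) : ObjectProperty B := R.dual.vee T

/-- `T^⊥`. -/
def perp (T : ObjectProperty B) : ObjectProperty B := fun X => ∀ Y, T Y → ∀ n, R.V n Y X

/-- `X` has projective dimension at most `m`. -/
def Pd (m : ℕ) (X : B) : Prop := ∀ Y i, m ≤ i → R.V i X Y

/-- `X` has injective dimension at most `m`. -/
def Id (m : ℕ) (X : B) : Prop := ∀ Y i, m ≤ i → R.V i Y X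

/-- `T` is a subcategory of finite projective dimension without self-extensions. -/
structure PreTilting (n : ℕ) (T : ObjectProperty B) : Prop where
  sub : IsSubcategory T
  pd : ∀ X, T X → R.Pd n X
  ext : ∀ X Y, T X → T Y → ∀ i, R.V i X Y

structure Cotorsion (U W : ObjectProperty B) : Prop where
  left : IsSubcategory U
  right : IsSubcategory W
  ext : ∀ X Y, U X → W Y → R.V 0 X Y
  cone : ∀ X, ∃ Y Z, W Y ∧ U Z ∧ R.Tr Y Z X
  cocone : ∀ X, ∃ Y Z, W Y ∧ U Z ∧ R.Tr X Y Z

/-- `pd 𝓘 ≤ d` and `id 𝓟 ≤ d`. -/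
structure Gorenstein (d : ℕ) : Prop where
  pd : ∀ I, R.IsInj I → R.Pd d I
  id : ∀ P, R.IsProj P → R.Id d P

variable {R} {T : ObjectProperty B} {n : ℕ}

section Basic

lemma tr_self (R : ExactRel B) {X Z : B} (hZ : IsZero Z) : R.Tr X X Z := by
  refine R.tr_iso (Iso.refl X) ⟨biprod.fst, biprod.inl, ?_, by simp⟩ (Iso.refl Z) (R.tr_biprod X Z)
  ext
  · simp
  · exact hZ.eq_of_tgt _ _
  · exact hZ.eq_of_src _ _
  · exact hZ.eq_of_tgt _ _

lemma tr_biprod' (R : ExactRel B) (A C : B) : R.Tr C (A ⊞ C) A :=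
  R.tr_iso (Iso.refl _) (biprod.braiding C A) (Iso.refl _) (R.tr_biprod C A)

lemma left_zero (R : ExactRel B) {Z : B} (hZ : IsZero Z) (n : ℕ) (Y : B) : R.V n Z Y := by
  obtain ⟨K, P, -, hP⟩ := R.enough_proj Y
  exact R.left_fst (R.dual.tr_self hZ) (hP n Y) (hP (n + 1) Y)

lemma left_iso {X X' Y : B} (e : X ≅ X') (h : R.V n X Y) : R.V n X' Y :=
  R.left_mid (R.tr_iso (Iso.refl X) e (Iso.refl 0) (R.tr_self (isZero_zero B))) h
    (R.left_zero (isZero_zero B) n Y)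

lemma right_iso {X X' Y : B} (e : X ≅ X') (h : R.V n Y X) : R.V n Y X' :=
  left_iso (R := R.dual) e h

lemma isSubcategory_isInj (R : ExactRel B) : IsSubcategory R.IsInj where
  of_iso e h n Y := right_iso e (h n Y)
  zero hZ n Y := R.dual.left_zero hZ n Y
  sum hX hY n Z := R.right_mid (R.tr_biprod _ _) (hX n Z) (hY n Z)
  summand h n Y := R.right_summand (h n Y)

lemma perp_iso {X X' : B} (e : X ≅ X') (h : R.perp T X) : R.perp T X' :=
  fun Y hY n => right_iso e (h Y hY n)

lemma perp_mid {A M C : B} (h : R.Tr A M C) (hA : R.perp T A) (hC : R.perp T C) : R.perp T M :=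
  fun Y hY n => R.right_mid h (hA Y hY n) (hC Y hY n)

lemma perp_snd {A M C : B} (h : R.Tr A M C) (hA : R.perp T A) (hM : R.perp T M) : R.perp T C :=
  fun Y hY n => R.right_snd h (hM Y hY n) (hA Y hY _)

lemma isSubcategory_perp (R : ExactRel B) (T : ObjectProperty B) : IsSubcategory (R.perp T) where
  of_iso := perp_iso
  zero hZ Y _ n := R.dual.left_zero hZ n Y
  sum hX hY := perp_mid (R.tr_biprod _ _) hX hY
  summand h Y hY n := R.right_summand (h Y hY n)

lemma IsInj.perp {I : B} (h : R.IsInj I) : R.perp T I := fun Y _ n => h n Y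

end Basic

/-! ### Objects with finite `T`-coresolutions. -/

section Vee

lemma veeN_iso (hT : IsSubcategory T) {X X' : B} (e : X ≅ X') (h : R.veeN T n X) :
    R.veeN T n X' := by
  cases n with
  | zero => exact hT.of_iso e h
  | succ n =>
    obtain ⟨U, W, hU, hW, h⟩ := h
    exact ⟨U, W, hU, hW, R.tr_iso e (Iso.refl _) (Iso.refl _) h⟩

lemma veeN_succ (hT : IsSubcategory T) {X : B} (h : R.veeN T n X) : R.veeN T (n + 1) X := by
  induction n generalizing X with
  | zero => exact ⟨X, 0, h, hT.zero (isZero_zero B), R.tr_self (isZero_zero B)⟩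
  | succ n ih =>
    obtain ⟨U, W, hU, hW, h⟩ := h
    exact ⟨U, W, hU, ih hW, h⟩

lemma veeN_mono (hT : IsSubcategory T) {m : ℕ} (hnm : n ≤ m) {X : B} (h : R.veeN T n X) :
    R.veeN T m X := by
  induction hnm with
  | refl => exact h
  | step _ ih => exact veeN_succ hT ih

lemma vee_cases (hT : IsSubcategory T) {X : B} (h : R.vee T X) :
    ∃ U W, T U ∧ R.vee T W ∧ R.Tr X U W := by
  obtain ⟨n, h⟩ := h
  obtain ⟨U, W, hU, hW, h⟩ := veeN_succ hT h
  exact ⟨U, W, hU, ⟨n, hW⟩, h⟩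

lemma vee_of_mem {X : B} (h : T X) : R.vee T X := ⟨0, h⟩

lemma vee_of_tr {X U W : B} (hU : T U) (hW : R.vee T W) (h : R.Tr X U W) : R.vee T X := by
  obtain ⟨n, hn⟩ := hW
  exact ⟨n + 1, U, W, hU, hn, h⟩

lemma vee_induction {p : B → Prop} (h0 : ∀ X, T X → p X)
    (hs : ∀ X U W, T U → p W → R.Tr X U W → p X) {X : B} (h : R.vee T X) : p X := by
  obtain ⟨n, h⟩ := h
  induction n generalizing X with
  | zero => exact h0 X h
  | succ n ih =>
    obtain ⟨U, W, hU, hW, h⟩ := h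
    exact hs X U W hU (ih hW) h

lemma vee_ext_perp {X Y : B} (hX : R.vee T X) (hY : R.perp T Y) (i : ℕ) : R.V i X Y := by
  revert i
  refine vee_induction (p := fun X => ∀ i, R.V i X Y) (fun X hX => hY X hX) ?_ hX
  exact fun X U W hU hW h i => R.left_fst h (hY U hU i) (hW (i + 1))

lemma PreTilting.mem_perp (hT : R.PreTilting n T) {X : B} (h : T X) : R.perp T X :=
  fun Y hY i => hT.ext Y X hY h i

lemma PreTilting.vee_pd (hT : R.PreTilting n T) {X : B} (h : R.vee T X) : R.Pd n X :=
  vee_induction (p := R.Pd n) hT.pd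
    (fun _ U _ hU hW h Y i hi => R.left_fst h (hT.pd U hU Y i hi) (hW Y (i + 1) (by omega))) h

lemma PreTilting.wedge_perp (hT : R.PreTilting n T) {X : B} (h : R.wedge T X) : R.perp T X :=
  vee_induction (R := R.dual) (p := R.perp T) (fun _ h => hT.mem_perp h)
    (fun _ _ _ hU hW h => perp_snd h hW (hT.mem_perp hU)) h

/-- An object of `T^∨ ∩ T^⊥` lies in `T`. -/
lemma PreTilting.mem_of_vee_of_perp (hT : R.PreTilting n T) {X : B} (h : R.vee T X)
    (h' : R.perp T X) : T X := by
  obtain ⟨U, W, hU, hW, h⟩ := vee_cases hT.sub h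
  obtain ⟨e⟩ := R.split h (vee_ext_perp hW h' 0)
  exact hT.sub.summand (hT.sub.of_iso e hU)

/-- Horseshoe lemma: the vanishing of extensions from `T^∨` to `T` makes the relevant pushouts
split, so `M` embeds in `U' ⊞ U` with cokernel an extension of `Y'` by `Y`. -/
lemma PreTilting.veeN_mid (hT : R.PreTilting n T) {m : ℕ} {A M C : B} (h : R.Tr A M C)
    (hA : R.veeN T m A) (hC : R.veeN T m C) : R.veeN T m M := by
  induction m generalizing A M C with
  | zero =>
    obtain ⟨e⟩ := R.split h (hT.ext C A hC hA 0)
    exact hT.sub.of_iso e.symm (hT.sub.sum hA hC)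
  | succ m ih =>
    have hC' : R.vee T C := ⟨_, hC⟩
    obtain ⟨U, Y, hU, hY, h₁⟩ := hA
    obtain ⟨U', Y', hU', hY', h₂⟩ := hC
    obtain ⟨W, h₃, h₄⟩ := R.pushout h h₁
    obtain ⟨e⟩ := R.split h₃ (vee_ext_perp hC' (hT.mem_perp hU) 0)
    obtain ⟨W', h₅, h₆⟩ := R.pushout h₂ (R.tr_biprod' U C)
    obtain ⟨e'⟩ := R.split h₆ (hT.ext U U' hU hU' 0)
    obtain ⟨Z, h₇, h₈⟩ := R.et4 (R.tr_iso (Iso.refl _) e (Iso.refl _) h₄) h₅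
    exact ⟨W', Z, hT.sub.of_iso e'.symm (hT.sub.sum hU' hU), ih h₈ hY hY', h₇⟩

lemma PreTilting.vee_mid (hT : R.PreTilting n T) {A M C : B} (h : R.Tr A M C)
    (hA : R.vee T A) (hC : R.vee T C) : R.vee T M := by
  obtain ⟨i, hA⟩ := hA
  obtain ⟨j, hC⟩ := hC
  exact ⟨max i j, hT.veeN_mid h (veeN_mono hT.sub (le_max_left i j) hA)
    (veeN_mono hT.sub (le_max_right i j) hC)⟩

lemma PreTilting.vee_iso (hT : R.PreTilting n T) {X X' : B} (e : X ≅ X') (h : R.vee T X) :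
    R.vee T X' := by
  obtain ⟨m, h⟩ := h
  exact ⟨m, veeN_iso hT.sub e h⟩

/-- The length of a coresolution is bounded by the vanishing of extensions. -/
lemma PreTilting.veeN_of_vanish (hT : R.PreTilting n T) {m : ℕ} {X : B} (h : R.vee T X)
    (hX : ∀ Y, R.vee T Y → R.V m Y X) : R.veeN T m X := by
  induction m generalizing X with
  | zero =>
    obtain ⟨U, W, hU, hW, h⟩ := vee_cases hT.sub h
    obtain ⟨e⟩ := R.split h (hX W hW)
    exact hT.sub.summand (hT.sub.of_iso e hU)
  | succ m ih =>
    obtain ⟨U, W, hU, hW, h⟩ := vee_cases hT.sub h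
    exact ⟨U, W, hU, ih hW fun Y hY =>
      R.right_snd h (vee_ext_perp hY (hT.mem_perp hU) m) (hX Y hY), h⟩

end Vee

/-! ### From special precovers to a cotorsion pair. -/

section Generator

/-- Every object of `T^⊥` has a special `T`-precover. -/
def Generates (R : ExactRel B) (T : ObjectProperty B) : Prop :=
  ∀ X, R.perp T X → ∃ K U, R.perp T K ∧ T U ∧ R.Tr K U X

/-- Salce's trick: cover `Y` by `U ∈ T` and take for `Z'` the fibre of the composite `U → Y → Z`. -/
lemma Generates.cone_of_cocone (hg : R.Generates T) {X Y Z : B}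
    (hY : R.perp T Y) (hZ : R.vee T Z) (h : R.Tr X Y Z) :
    ∃ Y' Z', R.perp T Y' ∧ R.vee T Z' ∧ R.Tr Y' Z' X := by
  obtain ⟨K, U, hK, hU, h'⟩ := hg Y hY
  obtain ⟨W, h₁, h₂⟩ := R.et4_op h' h
  exact ⟨K, W, hK, vee_of_tr hU hZ h₁, h₂⟩

lemma Generates.exists_cocone (hT : R.PreTilting n T) (hg : R.Generates T) (X : B) :
    ∃ Y Z, R.perp T Y ∧ R.vee T Z ∧ R.Tr X Y Z := by
  -- Induction on the degree from which extensions from `T` to `X` vanish; the bound `pd T ≤ n`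
  -- starts it, and a cosyzygy lowers it by one.
  suffices H : ∀ m X, (∀ U, T U → ∀ i, m ≤ i → R.V i U X) →
      ∃ Y Z, R.perp T Y ∧ R.vee T Z ∧ R.Tr X Y Z from
    H n X fun U hU i hi => hT.pd U hU X i hi
  intro m
  induction m with
  | zero =>
    exact fun X hX => ⟨X, 0, fun U hU i => hX U hU i (Nat.zero_le i),
      vee_of_mem (hT.sub.zero (isZero_zero B)), R.tr_self (isZero_zero B)⟩
  | succ m ih =>
    intro X hX
    obtain ⟨I, C, h, hI⟩ := R.enough_inj X
    obtain ⟨Y, Z, hY, hZ, h'⟩ := ih C fun U hU i hi =>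
      R.right_snd h (hI i U) (hX U hU (i + 1) (by omega))
    obtain ⟨Y', Z', hY', hZ', h₁⟩ := hg.cone_of_cocone hY hZ h'
    obtain ⟨W, h₂, h₃⟩ := R.pullback h h₁
    exact ⟨W, Z', perp_mid h₃ hY' (IsInj.perp hI), hZ', h₂⟩

lemma Generates.exists_cone (hT : R.PreTilting n T) (hg : R.Generates T) (X : B) :
    ∃ Y Z, R.perp T Y ∧ R.vee T Z ∧ R.Tr Y Z X := by
  obtain ⟨Y, Z, hY, hZ, h⟩ := hg.exists_cocone hT X
  exact hg.cone_of_cocone hY hZ h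

/-- In `X → Y → Z`, neither `X` nor `Z` has extensions by the kernel `K` of a cover of `Y`, so the
cover splits and `Y ∈ T`. This description by orthogonality yields closure of `T^∨` under summands.
-/
lemma Generates.vee_of_ext (hT : R.PreTilting n T) (hg : R.Generates T) {X : B}
    (hX : ∀ Y, R.perp T Y → R.V 0 X Y) : R.vee T X := by
  obtain ⟨Y, Z, hY, hZ, h⟩ := hg.exists_cocone hT X
  obtain ⟨K, U, hK, hU, h'⟩ := hg Y hY
  obtain ⟨e⟩ := R.split h' (R.left_mid h (hX K hK) (vee_ext_perp hZ hK 0))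
  exact vee_of_tr (hT.sub.summand (hT.sub.of_iso (e ≪≫ biprod.braiding _ _) hU)) hZ h

lemma Generates.cotorsion (hT : R.PreTilting n T) (hg : R.Generates T) :
    R.Cotorsion (R.vee T) (R.perp T) where
  left :=
    { of_iso := hT.vee_iso
      zero := fun hZ => vee_of_mem (hT.sub.zero hZ)
      sum := fun hX hY => hT.vee_mid (R.tr_biprod _ _) hX hY
      summand := fun h => hg.vee_of_ext hT fun _ hY => R.left_summand (vee_ext_perp h hY 0) }
  right := R.isSubcategory_perp T
  ext _ _ hX hY := vee_ext_perp hX hY 0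
  cone := hg.exists_cone hT
  cocone := hg.exists_cocone hT

lemma Generates.wedgeN_of_vanish (hT : R.PreTilting n T) (hg : R.Generates T) {m : ℕ} {X : B}
    (h : R.perp T X) (hX : ∀ Y, R.perp T Y → R.V m X Y) : R.wedgeN T m X := by
  induction m generalizing X with
  | zero =>
    obtain ⟨K, U, hK, hU, h'⟩ := hg X h
    obtain ⟨e⟩ := R.split h' (hX K hK)
    exact hT.sub.summand (hT.sub.of_iso (e ≪≫ biprod.braiding _ _) hU)
  | succ m ih =>
    obtain ⟨K, U, hK, hU, h'⟩ := hg X h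
    exact ⟨U, K, hU, ih hK fun Y hY => R.left_fst h' (hY U hU m) (hX Y hY), h'⟩

end Generator

/-! ### Existence of special precovers in the Gorenstein case. -/

section Gorenstein

variable {d : ℕ}

lemma Id.mid {m m' : ℕ} {A M C : B} (h : R.Tr A M C) (hA : R.Id m A) (hC : R.Id m' C) :
    R.Id (max m m') M :=
  fun Y i hi => R.right_mid h (hA Y i (le_trans (le_max_left _ _) hi))
    (hC Y i (le_trans (le_max_right _ _) hi))

lemma Id.snd {m m' : ℕ} {A M C : B} (h : R.Tr A M C) (hA : R.Id m A) (hM : R.Id m' M) :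
    R.Id (max m m') C :=
  fun Y i hi => R.right_snd h (hM Y i (le_trans (le_max_right _ _) hi))
    (hA Y (i + 1) (by have := le_max_left m m'; omega))

lemma IsInj.id {I : B} (h : R.IsInj I) : R.Id 0 I := fun Y i _ => h i Y

/-- Dimension shifting along a finite injective coresolution of `L`. -/
lemma Id.ext_perp_isInj {m : ℕ} {L X : B} (hL : R.Id m L) (hX : R.perp R.IsInj X) (i : ℕ) :
    R.V i L X := by
  induction m generalizing L i with
  | zero => exact hX L (fun n Y => hL Y n (Nat.zero_le n)) i
  | succ m ih =>
    obtain ⟨I, C, h, hI⟩ := R.enough_inj L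
    refine R.left_fst h (hX I hI i) (ih (fun Y j hj => ?_) _)
    exact R.right_snd h (hI j Y) (hL Y (j + 1) (by omega))

/-- In a Gorenstein category, objects of finite projective dimension have bounded injective
dimension. -/
lemma Gorenstein.id_of_pd (hG : R.Gorenstein d) {m : ℕ} {X : B} (h : R.Pd m X) : R.Id d X := by
  induction m generalizing X with
  | zero => exact hG.id X fun n Y => h Y n (Nat.zero_le n)
  | succ m ih =>
    obtain ⟨K, P, h', hP⟩ := R.enough_proj X
    have hK := ih (X := K) fun Y i hi => R.left_fst h' (hP i Y) (h Y (i + 1) (by omega))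
    exact fun Y i hi => R.right_snd h' (hG.id P hP Y i hi) (hK Y (i + 1) (by omega))

/-- `X` is an `m`-th cosyzygy. -/
def IsCosyzygy (R : ExactRel B) : ℕ → B → Prop
  | 0, _ => True
  | m + 1, X => ∃ Y I, IsCosyzygy R m Y ∧ R.IsInj I ∧ R.Tr Y I X

lemma IsCosyzygy.perp (hd : ∀ I, R.IsInj I → R.Pd d I) {X : B} (h : R.IsCosyzygy d X) :
    R.perp R.IsInj X := by
  suffices H : ∀ m X, R.IsCosyzygy m X → ∀ J, R.IsInj J → ∀ i, d ≤ i + m → R.V i J X from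
    fun J hJ i => H d X h J hJ i (by omega)
  intro m
  induction m with
  | zero => exact fun X _ J hJ i hi => hd J hJ X i hi
  | succ m ih =>
    rintro X ⟨Y, I, hY, hI, h⟩ J hJ i hi
    exact R.right_snd h (hI i J) (ih Y hY J hJ (i + 1) (by omega))

lemma Gorenstein.exists_cosyzygy (hG : R.Gorenstein d) (m : ℕ) (X : B) :
    ∃ X' L k, R.IsCosyzygy m X' ∧ R.Id k L ∧ R.Tr X X' L := by
  induction m generalizing X with
  | zero =>
    exact ⟨X, 0, 0, trivial, IsInj.id (R.isSubcategory_isInj.zero (isZero_zero B)),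
      R.tr_self (isZero_zero B)⟩
  | succ m ih =>
    -- The induction applies to the syzygy `K`, giving a cosyzygy `K'`. With `K' → I → C`, the
    -- object `J ⊞ C` is a cosyzygy of `K'`, and `X` embeds in it through `I ⊞ X`. The cokernel `L'`
    -- is an extension of `D` by `I`, where `D` is a cosyzygy of `W`; the latter has finite
    -- injective dimension because `id 𝓟 ≤ d`.
    obtain ⟨K, P, hK, hP⟩ := R.enough_proj X
    obtain ⟨K', L, k, hK', hL, h₁⟩ := ih K
    obtain ⟨W, h₂, h₃⟩ := R.pushout hK h₁
    have hW := Id.mid h₃ (hG.id P hP) hL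
    obtain ⟨I, C, hI', hI⟩ := R.enough_inj K'
    obtain ⟨Y, h₄, h₅⟩ := R.pushout h₂ hI'
    obtain ⟨e⟩ := R.split h₄ (hI 0 X)
    obtain ⟨J, D, hJ', hJ⟩ := R.enough_inj W
    obtain ⟨Y', h₆, h₇⟩ := R.pushout hJ' (R.tr_iso (Iso.refl _) e (Iso.refl _) h₅)
    obtain ⟨e'⟩ := R.split h₇ (hJ 0 C)
    obtain ⟨L', h₈, h₉⟩ := R.et4 (R.tr_biprod' I X) h₆
    obtain ⟨V, h₁₀, h₁₁⟩ := R.pullback hI' (R.tr_biprod J C)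
    obtain ⟨e''⟩ := R.split h₁₁ (hJ 0 I)
    refine ⟨J ⊞ C, L', _, ⟨K', V, hK', ?_, h₁₀⟩,
      Id.mid h₉ (IsInj.id hI) (Id.snd hJ' hW (IsInj.id hJ)),
      R.tr_iso (Iso.refl _) e' (Iso.refl _) h₈⟩
    exact R.isSubcategory_isInj.of_iso e''.symm (R.isSubcategory_isInj.sum hJ hI)

lemma Gorenstein.generates_isInj (hG : R.Gorenstein d) : R.Generates R.IsInj := by
  intro X hX
  -- One of the `d + 1` steps supplies the injective `I`; the other `d` put the kernel `K` in `𝓘^⊥`.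
  obtain ⟨X', L, k, ⟨K, I, hK, hI, h⟩, hL, h'⟩ := hG.exists_cosyzygy (d + 1) X
  have hK' := hK.perp hG.pd
  obtain ⟨e⟩ := R.split h' (hL.ext_perp_isInj hX 0)
  have hL' : R.perp R.IsInj L := perp_snd h' hX (perp_snd h hK' (IsInj.perp hI))
  obtain ⟨Z, h₁, h₂⟩ := R.et4_op (R.tr_iso (Iso.refl _) (Iso.refl _) e h) (R.tr_biprod' X L)
  exact ⟨Z, I, perp_mid h₂ hK' hL', hI, h₁⟩

lemma Gorenstein.preTilting_isInj (hG : R.Gorenstein d) : R.PreTilting d R.IsInj where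
  sub := R.isSubcategory_isInj
  pd := hG.pd
  ext _ _ _ hY i := hY i _

/-- The approximation triangles of objects of finite projective dimension. -/
lemma PreTilting.exists_wedge_vee (hT : R.PreTilting n T) (hP : ∀ P, R.IsProj P → R.vee T P)
    {m : ℕ} {X : B} (hX : R.Pd m X) : ∃ Y Z, R.wedge T Y ∧ R.vee T Z ∧ R.Tr X Y Z := by
  induction m generalizing X with
  | zero =>
    obtain ⟨U, W, hU, hW, h⟩ := vee_cases hT.sub (hP X fun n Y => hX Y n (Nat.zero_le n))
    exact ⟨U, W, vee_of_mem hU, hW, h⟩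
  | succ m ih =>
    obtain ⟨K, P, h, hP'⟩ := R.enough_proj X
    obtain ⟨Y, Z, hY, hZ, h₁⟩ :=
      ih (X := K) fun Y i hi => R.left_fst h (hP' i Y) (hX Y (i + 1) (by omega))
    -- The pushout `W` is an extension of `Z` by `P`, hence in `T^∨`. Embedding it in `U ∈ T` turns
    -- `Y → W → X` into `Y → U → Y'` and `X → Y' → W'`.
    obtain ⟨W, h₂, h₃⟩ := R.pushout h h₁
    obtain ⟨U, W', hU, hW', h₄⟩ := vee_cases hT.sub (hT.vee_mid h₃ (hP P hP') hZ)
    obtain ⟨Y', h₅, h₆⟩ := R.et4 h₂ h₄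
    exact ⟨Y', W', vee_of_tr (R := R.dual) hU hY h₅, hW', h₆⟩

lemma PreTilting.generates (hT : R.PreTilting n T) (hP : ∀ P, R.IsProj P → R.vee T P)
    (hG : R.Gorenstein d) : R.Generates T := by
  intro X hX
  obtain ⟨J, Z, hJ, hZ, h⟩ := hG.generates_isInj.exists_cone hG.preTilting_isInj X
  have hZ' : R.perp T Z := perp_mid h
    (fun U hU i => (hG.id_of_pd (hT.pd U hU)).ext_perp_isInj hJ i) hX
  obtain ⟨Y, W, hY, hW, h₁⟩ := hT.exists_wedge_vee hP (hG.preTilting_isInj.vee_pd hZ)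
  obtain ⟨U, K, hU, hK, h₂⟩ := vee_cases (R := R.dual) hT.sub hY
  obtain ⟨e⟩ := R.split h₁ (vee_ext_perp hW hZ' 0)
  have hW' : R.perp T W := perp_snd h₁ hZ' (hT.wedge_perp hY)
  -- The cover `U → Y ≅ Z ⊞ W` is composed with the projection to `Z`, then with `Z → X`. The final
  -- kernel is built by extensions from `K`, `W` and `J`, all in `T^⊥`.
  obtain ⟨L, h₃, h₄⟩ := R.et4_op (R.tr_iso (Iso.refl _) (Iso.refl _) e h₂) (R.tr_biprod' Z W)
  obtain ⟨L', h₅, h₆⟩ := R.et4_op h₃ h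
  exact ⟨L', U, perp_mid h₆ (perp_mid h₄ (hT.wedge_perp hK) hW')
    (fun U hU i => (hG.id_of_pd (hT.pd U hU)).ext_perp_isInj hJ i), hU, h₅⟩

lemma PreTilting.cotorsion (hT : R.PreTilting n T) (hP : ∀ P, R.IsProj P → R.vee T P)
    (hG : R.Gorenstein d) : R.Cotorsion (R.vee T) (R.perp T) :=
  (hT.generates hP hG).cotorsion hT

/-- The passage between tilting and cotilting: iterated covers of an injective stop after `d` steps
because `pd 𝓘 ≤ d`. -/
lemma PreTilting.isInj_wedgeN (hT : R.PreTilting n T) (hP : ∀ P, R.IsProj P → R.vee T P)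
    (hG : R.Gorenstein d) {I : B} (hI : R.IsInj I) : R.wedgeN T d I :=
  (hT.generates hP hG).wedgeN_of_vanish hT (IsInj.perp hI) fun Y _ => hG.pd I hI Y d le_rfl

lemma PreTilting.isProj_veeN (hT : R.PreTilting n T) (h : R.Cotorsion (R.vee T) (R.perp T))
    {P : B} (hP : R.IsProj P) : R.veeN T n P := by
  obtain ⟨Y, Z, hY, hZ, h₁⟩ := h.cocone P
  obtain ⟨Y', Z', hY', hZ', h₂⟩ := h.cone Y
  -- As an extension of `Z ∈ T^∨` by a projective, `Y` has no extensions by `Y' ∈ T^⊥`. It is thus a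
  -- summand of `Z'`, so lies in `T^∨ ∩ T^⊥`.
  obtain ⟨e⟩ := R.split h₂ (R.left_mid h₁ (hP 0 Y') (vee_ext_perp hZ hY' 0))
  have hYT : T Y := hT.mem_of_vee_of_perp
    (h.left.summand (h.left.of_iso (e ≪≫ biprod.braiding _ _) hZ')) hY
  exact hT.veeN_of_vanish (vee_of_tr hYT hZ h₁) fun W hW => hT.vee_pd hW P n le_rfl

lemma Gorenstein.dual (hG : R.Gorenstein d) : R.dual.Gorenstein d := ⟨hG.id, hG.pd⟩

/-- A subcategory without self-extensions of finite projective dimension has finite injective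
dimension in a Gorenstein category. -/
lemma PreTilting.dual (hT : R.PreTilting n T) (hG : R.Gorenstein d) :
    R.dual.PreTilting d T where
  sub := hT.sub
  pd X hX := hG.id_of_pd (hT.pd X hX)
  ext X Y hX hY i := hT.ext Y X hY hX i

lemma Cotorsion.dual_iff {U W : ObjectProperty B} : R.dual.Cotorsion U W ↔ R.Cotorsion W U :=
  ⟨fun h => ⟨h.right, h.left, fun X Y hX hY => h.ext Y X hY hX,
      fun X => let ⟨Y, Z, hY, hZ, h⟩ := h.cocone X; ⟨Z, Y, hZ, hY, h⟩,
      fun X => let ⟨Y, Z, hY, hZ, h⟩ := h.cone X; ⟨Z, Y, hZ, hY, h⟩⟩,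
    fun h => ⟨h.right, h.left, fun X Y hX hY => h.ext Y X hY hX,
      fun X => let ⟨Y, Z, hY, hZ, h⟩ := h.cocone X; ⟨Z, Y, hZ, hY, h⟩,
      fun X => let ⟨Y, Z, hY, hZ, h⟩ := h.cone X; ⟨Z, Y, hZ, hY, h⟩⟩⟩

end Gorenstein

end ExactRel

namespace Structure

variable {B : Type u} [Category.{v} B] [Preadditive B] [HasZeroObject B] [HasBinaryBiproducts B]
  {S : Structure.{w} B}

/-! ### Higher extensions through syzygies. -/

section Vanishing

lemma extVanish_zero_iff {X Y : B} : S.ExtVanish 0 X Y ↔ ∀ δ : Extn S.E X Y, δ = 0 :=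
  ⟨fun h => h X rfl, fun h Z hZ => by obtain rfl : Z = X := hZ; exact h⟩

lemma extVanish_zero_of_iso {X X' Y : B} (e : X ≅ X') (h : S.ExtVanish 0 X Y) :
    S.ExtVanish 0 X' Y := by
  rw [extVanish_zero_iff] at h ⊢
  intro δ
  rw [← pull_id S.E δ, ← e.inv_hom_id, pull_comp, h (pull S.E e.hom δ), pull_zero]

lemma extVanish_zero_left_summand {X X' Y : B} (h : S.ExtVanish 0 (X ⊞ X') Y) :
    S.ExtVanish 0 X Y := by
  rw [extVanish_zero_iff] at h ⊢
  intro δ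
  rw [← pull_id S.E δ, ← biprod.inl_fst (X := X) (Y := X'), pull_comp,
    h (pull S.E biprod.fst δ), pull_zero]

lemma extVanish_right_summand {X X' Y : B} {n : ℕ} (h : S.ExtVanish n Y (X ⊞ X')) :
    S.ExtVanish n Y X := by
  intro Z hZ δ
  rw [← push_id S.E δ, ← biprod.inl_fst (X := X) (Y := X'), push_comp,
    h Z hZ (push S.E biprod.inl δ), push_zero]

lemma Tr.zero_left_mid {A M C Y : B} (h : S.Tr A M C) (hA : S.ExtVanish 0 A Y)
    (hC : S.ExtVanish 0 C Y) : S.ExtVanish 0 M Y := by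
  rw [extVanish_zero_iff] at hA hC ⊢
  obtain ⟨x, y, δ, h⟩ := h
  intro θ
  obtain ⟨θ', rfl⟩ := h.exists_pull_snd θ (hA _)
  rw [hC θ', pull_zero]

lemma Tr.zero_right_mid {A M C X : B} (h : S.Tr A M C) (hA : S.ExtVanish 0 X A)
    (hC : S.ExtVanish 0 X C) : S.ExtVanish 0 X M := by
  rw [extVanish_zero_iff] at hA hC ⊢
  obtain ⟨x, y, δ, h⟩ := h
  intro θ
  obtain ⟨θ', rfl⟩ := h.exists_push_fst θ (hC _)
  rw [hA θ', push_zero]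

lemma tr_biprod (S : Structure.{w} B) (A C : B) : S.Tr A (A ⊞ C) C := (S.real_zero A C).tr

lemma tr_biprod' (S : Structure.{w} B) (A C : B) : S.Tr C (A ⊞ C) A :=
  (S.tr_biprod C A).iso (Iso.refl _) (biprod.braiding C A) (Iso.refl _)

lemma Tr.split {A M C : B} (h : S.Tr A M C) (hV : S.ExtVanish 0 C A) : Nonempty (M ≅ A ⊞ C) := by
  obtain ⟨x, y, δ, h⟩ := h
  obtain ⟨b, -⟩ := h.exists_iso (extVanish_zero_iff.1 hV δ)
  exact ⟨b⟩

lemma Tr.pullback {A₁ M₁ A₂ M₂ C : B} (h₁ : S.Tr A₁ M₁ C) (h₂ : S.Tr A₂ M₂ C) :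
    ∃ W, S.Tr A₁ W M₂ ∧ S.Tr A₂ W M₁ := by
  obtain ⟨_, _, _, h₁⟩ := h₁
  obtain ⟨_, _, _, h₂⟩ := h₂
  exact h₁.exists_pullback h₂

lemma Tr.pushout {A M₁ C₁ M₂ C₂ : B} (h₁ : S.Tr A M₁ C₁) (h₂ : S.Tr A M₂ C₂) :
    ∃ W, S.Tr M₂ W C₁ ∧ S.Tr M₁ W C₂ := by
  obtain ⟨_, _, _, h₁⟩ := h₁
  obtain ⟨_, _, _, h₂⟩ := h₂
  exact h₁.exists_pushout h₂

lemma proj_iff {P : B} : S.proj P ↔ ∀ Y, S.ExtVanish 0 P Y := by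
  simp only [extVanish_zero_iff]
  constructor
  · intro hP Y δ
    obtain ⟨M, x, y, h⟩ := S.real_exists δ
    obtain ⟨s, hs⟩ := hP x y ⟨δ, h⟩ (𝟙 P)
    rw [← pull_id S.E δ, ← hs, pull_comp, h.pull_eq_zero, pull_zero]
  · rintro h A M C x y ⟨δ, hδ⟩ c
    exact hδ.exists_lift c (h A _)

lemma inj_iff_zero {I : B} : S.inj I ↔ ∀ Y, S.ExtVanish 0 Y I := by
  simp only [extVanish_zero_iff]
  constructor
  · intro hI Y δ
    obtain ⟨M, x, y, h⟩ := S.real_exists δ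
    obtain ⟨s, hs⟩ := hI x y ⟨δ, h⟩ (𝟙 I)
    rw [← push_id S.E δ, ← hs, push_comp, h.push_eq_zero, push_zero]
  · rintro h A M C x y ⟨δ, hδ⟩ c
    exact hδ.exists_desc c (h C _)

lemma inj_iff {I : B} : S.inj I ↔ ∀ n Y, S.ExtVanish n Y I := by
  rw [inj_iff_zero]
  exact ⟨fun h n Y Z _ => extVanish_zero_iff.1 (h Z), fun h => h 0⟩

lemma proj_of_iso {P P' : B} (e : P ≅ P') (h : S.proj P) : S.proj P' := by
  rw [proj_iff] at h ⊢
  exact fun Y => extVanish_zero_of_iso e (h Y)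

lemma proj_of_tr {A M C : B} (h : S.Tr A M C) (hA : S.proj A) (hC : S.proj C) : S.proj M := by
  rw [proj_iff] at hA hC ⊢
  exact fun Y => h.zero_left_mid (hA Y) (hC Y)

lemma proj_summand {P P' : B} (h : S.proj (P ⊞ P')) : S.proj P := by
  rw [proj_iff] at h ⊢
  exact fun Y => extVanish_zero_left_summand (h Y)

/-- `Z` is a first syzygy of `X`. -/
def Syz (S : Structure.{w} B) (X Z : B) : Prop := ∃ P, S.proj P ∧ S.Tr Z P X

/-- The definition peels off the last syzygy; dimension shifting needs the first one. -/
lemma isSyzygy_succ_iff {n : ℕ} {X Z : B} :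
    S.IsSyzygy (n + 1) X Z ↔ ∃ K, S.Syz X K ∧ S.IsSyzygy n K Z := by
  induction n generalizing Z with
  | zero =>
    constructor
    · rintro ⟨Y, P, x, y, hY, hP, h⟩
      obtain rfl : Y = X := hY
      exact ⟨Z, ⟨P, hP, x, y, h⟩, rfl⟩
    · rintro ⟨K, ⟨P, hP, x, y, h⟩, hK⟩
      obtain rfl : Z = K := hK
      exact ⟨X, P, x, y, rfl, hP, h⟩
  | succ n ih =>
    constructor
    · rintro ⟨Y, P, x, y, hY, hP, h⟩
      obtain ⟨K, hK, hY⟩ := ih.1 hY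
      exact ⟨K, hK, Y, P, x, y, hY, hP, h⟩
    · rintro ⟨K, hK, Y, P, x, y, hY, hP, h⟩
      exact ⟨Y, P, x, y, ih.2 ⟨K, hK, hY⟩, hP, h⟩

lemma extVanish_succ_iff_forall {n : ℕ} {X Y : B} :
    S.ExtVanish (n + 1) X Y ↔ ∀ K, S.Syz X K → S.ExtVanish n K Y :=
  ⟨fun h K hK Z hZ => h Z (isSyzygy_succ_iff.2 ⟨K, hK, hZ⟩), fun h Z hZ => by
    obtain ⟨K, hK, hZ⟩ := isSyzygy_succ_iff.1 hZ
    exact h K hK Z hZ⟩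

lemma Syz.iso {X X' Z : B} (e : X ≅ X') (h : S.Syz X Z) : S.Syz X' Z := by
  obtain ⟨P, hP, h⟩ := h
  exact ⟨P, hP, h.iso (Iso.refl _) (Iso.refl _) e⟩

lemma Syz.biprod_proj {X Z P : B} (h : S.Syz X Z) (hP : S.proj P) : S.Syz (X ⊞ P) Z := by
  obtain ⟨Q, hQ, h⟩ := h
  obtain ⟨W, h₁, h₂⟩ := h.pullback (S.tr_biprod' X P)
  exact ⟨W, proj_of_tr h₂ hP hQ, h₁⟩

/-- Rotation of an `𝔼`-triangle. -/
lemma Tr.rotate {A M C K : B} (h : S.Tr A M C) (hK : S.Syz C K) :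
    ∃ P, S.proj P ∧ S.Tr K (A ⊞ P) M := by
  obtain ⟨P, hP, h'⟩ := hK
  obtain ⟨W, h₁, h₂⟩ := h.pullback h'
  obtain ⟨e⟩ := h₁.split (proj_iff.1 hP A)
  exact ⟨P, hP, h₂.iso (Iso.refl _) e (Iso.refl _)⟩

/-- Schanuel's lemma. -/
lemma Syz.schanuel {X Z Z' : B} (h : S.Syz X Z) (h' : S.Syz X Z') :
    ∃ P P', S.proj P ∧ S.proj P' ∧ Nonempty (Z ⊞ P ≅ Z' ⊞ P') := by
  obtain ⟨P, hP, h⟩ := h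
  obtain ⟨P', hP', h'⟩ := h'
  obtain ⟨W, h₁, h₂⟩ := h.pullback h'
  obtain ⟨e⟩ := h₁.split (proj_iff.1 hP' Z)
  obtain ⟨e'⟩ := h₂.split (proj_iff.1 hP Z')
  exact ⟨P', P, hP', hP, ⟨e.symm ≪≫ e'⟩⟩

lemma EnoughProjectives.exists_syz (hS : S.EnoughProjectives) (X : B) : ∃ K, S.Syz X K := by
  obtain ⟨K, P, x, y, hP, h⟩ := hS X
  exact ⟨K, P, hP, x, y, h⟩

/-- Schanuel's lemma keeps syzygies of stably isomorphic objects stably isomorphic. Consequently a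
single choice of syzygy suffices to test vanishing. -/
lemma extVanish_of_stable_iso (hS : S.EnoughProjectives) {n : ℕ} {X X' P P' Y : B}
    (hP : S.proj P) (hP' : S.proj P')
    (e : X ⊞ P ≅ X' ⊞ P') (h : S.ExtVanish n X Y) : S.ExtVanish n X' Y := by
  induction n generalizing X X' P P' with
  | zero =>
    exact extVanish_zero_left_summand
      (extVanish_zero_of_iso e ((S.tr_biprod X P).zero_left_mid h (proj_iff.1 hP Y)))
  | succ n ih =>
    rw [extVanish_succ_iff_forall] at h ⊢
    intro K' hK'
    obtain ⟨K, hK⟩ := hS.exists_syz X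
    obtain ⟨Q, Q', hQ, hQ', ⟨f⟩⟩ := ((hK.biprod_proj hP).iso e).schanuel (hK'.biprod_proj hP')
    exact ih hQ hQ' f (h K hK)

lemma extVanish_succ_iff (hS : S.EnoughProjectives) {n : ℕ} {X K Y : B} (hK : S.Syz X K) :
    S.ExtVanish (n + 1) X Y ↔ S.ExtVanish n K Y := by
  rw [extVanish_succ_iff_forall]
  refine ⟨fun h => h K hK, fun h K' hK' => ?_⟩
  obtain ⟨P, P', hP, hP', ⟨e⟩⟩ := hK.schanuel hK'
  exact extVanish_of_stable_iso hS hP hP' e h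

lemma extVanish_biprod_proj_iff (hS : S.EnoughProjectives) {n : ℕ} {X P Y : B} (hP : S.proj P) :
    S.ExtVanish n (X ⊞ P) Y ↔ S.ExtVanish n X Y := by
  cases n with
  | zero =>
    exact ⟨extVanish_zero_left_summand,
      fun h => (S.tr_biprod X P).zero_left_mid h (proj_iff.1 hP Y)⟩
  | succ n =>
    obtain ⟨K, hK⟩ := hS.exists_syz X
    rw [extVanish_succ_iff hS hK, extVanish_succ_iff hS (hK.biprod_proj hP)]

lemma proj.extVanish (hS : S.EnoughProjectives) {P : B} (hP : S.proj P) (n : ℕ) (Y : B) :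
    S.ExtVanish n P Y := by
  induction n generalizing P with
  | zero => exact proj_iff.1 hP Y
  | succ n ih =>
    obtain ⟨K, hK⟩ := hS.exists_syz P
    rw [extVanish_succ_iff hS hK]
    obtain ⟨Q, hQ, h⟩ := hK
    obtain ⟨e⟩ := h.split (proj_iff.1 hP K)
    exact ih (proj_summand (proj_of_iso e hQ))

lemma Syz.biprod {X X' K K' : B} (h : S.Syz X K) (h' : S.Syz X' K') :
    S.Syz (X ⊞ X') (K ⊞ K') := by
  obtain ⟨P, hP, _, _, _, h⟩ := h
  obtain ⟨P', hP', _, _, _, h'⟩ := h'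
  exact ⟨P ⊞ P', proj_of_tr (S.tr_biprod P P') hP hP', (S.real_sum h h').tr⟩

lemma extVanish_left_summand (hS : S.EnoughProjectives) {n : ℕ} {X X' Y : B}
    (h : S.ExtVanish n (X ⊞ X') Y) : S.ExtVanish n X Y := by
  induction n generalizing X X' with
  | zero => exact extVanish_zero_left_summand h
  | succ n ih =>
    obtain ⟨K, hK⟩ := hS.exists_syz X
    obtain ⟨K', hK'⟩ := hS.exists_syz X'
    rw [extVanish_succ_iff hS (hK.biprod hK')] at h
    rw [extVanish_succ_iff hS hK]
    exact ih h

lemma Tr.left_mid (hS : S.EnoughProjectives) {n : ℕ} {A M C Y : B} (h : S.Tr A M C)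
    (hA : S.ExtVanish n A Y) (hC : S.ExtVanish n C Y) : S.ExtVanish n M Y := by
  induction n generalizing A M C with
  | zero => exact h.zero_left_mid hA hC
  | succ n ih =>
    -- Three rotations replace the triangle by one on first syzygies of its terms, up to projective
    -- summands.
    obtain ⟨K, hK⟩ := hS.exists_syz C
    obtain ⟨P, hP, h₁⟩ := h.rotate hK
    obtain ⟨L, hL⟩ := hS.exists_syz M
    obtain ⟨Q, hQ, h₂⟩ := h₁.rotate hL
    obtain ⟨J, hJ⟩ := hS.exists_syz (A ⊞ P)
    obtain ⟨Q', hQ', h₃⟩ := h₂.rotate hJ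
    rw [← extVanish_biprod_proj_iff hS hP, extVanish_succ_iff hS hJ] at hA
    rw [extVanish_succ_iff hS hK, ← extVanish_biprod_proj_iff hS hQ] at hC
    rw [extVanish_succ_iff hS hL, ← extVanish_biprod_proj_iff hS hQ']
    exact ih h₃ hA hC

lemma Tr.left_fst (hS : S.EnoughProjectives) {n : ℕ} {A M C Y : B} (h : S.Tr A M C)
    (hM : S.ExtVanish n M Y) (hC : S.ExtVanish (n + 1) C Y) : S.ExtVanish n A Y := by
  obtain ⟨K, hK⟩ := hS.exists_syz C
  obtain ⟨P, hP, h₁⟩ := h.rotate hK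
  rw [extVanish_succ_iff hS hK] at hC
  exact (extVanish_biprod_proj_iff hS hP).1 (h₁.left_mid hS hC hM)

lemma Tr.left_snd (hS : S.EnoughProjectives) {n : ℕ} {A M C Y : B} (h : S.Tr A M C)
    (hA : S.ExtVanish n A Y) (hM : S.ExtVanish (n + 1) M Y) : S.ExtVanish (n + 1) C Y := by
  obtain ⟨K, hK⟩ := hS.exists_syz C
  obtain ⟨P, hP, h₁⟩ := h.rotate hK
  rw [← extVanish_biprod_proj_iff hS hP] at hA
  exact (extVanish_succ_iff hS hK).2 (h₁.left_fst hS hA hM)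

lemma Tr.right_mid (hS : S.EnoughProjectives) {n : ℕ} {A M C X : B} (h : S.Tr A M C)
    (hA : S.ExtVanish n X A) (hC : S.ExtVanish n X C) : S.ExtVanish n X M := by
  induction n generalizing X with
  | zero => exact h.zero_right_mid hA hC
  | succ n ih =>
    obtain ⟨K, hK⟩ := hS.exists_syz X
    rw [extVanish_succ_iff hS hK] at *
    exact ih hA hC

lemma Tr.right_snd (hS : S.EnoughProjectives) {n : ℕ} {A M C X : B} (h : S.Tr A M C)
    (hM : S.ExtVanish n X M) (hA : S.ExtVanish (n + 1) X A) : S.ExtVanish n X C := by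
  induction n generalizing X with
  | zero =>
    obtain ⟨K, hK⟩ := hS.exists_syz X
    rw [extVanish_succ_iff hS hK, extVanish_zero_iff] at hA
    rw [extVanish_zero_iff] at hM ⊢
    obtain ⟨P, hP, i, p, ε, hε⟩ := hK
    obtain ⟨x, y, δ, h⟩ := h
    intro θ
    -- Write `θ = c_* ε` with `c : K ⟶ C`. The obstruction to lifting `c` to `M` lies in `𝔼(K, A) =
    -- 𝔼²(X, A) = 0`.
    obtain ⟨c, rfl⟩ := hε.exists_push θ (extVanish_zero_iff.1 (proj_iff.1 hP C) _)
    obtain ⟨b, rfl⟩ := h.exists_lift c (hA _)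
    rw [push_comp, hM (push S.E b ε), push_zero]
  | succ n ih =>
    obtain ⟨K, hK⟩ := hS.exists_syz X
    rw [extVanish_succ_iff hS hK] at *
    exact ih hM hA

lemma Tr.right_fst (hS : S.EnoughProjectives) {n : ℕ} {A M C X : B} (h : S.Tr A M C)
    (hC : S.ExtVanish n X C) (hM : S.ExtVanish (n + 1) X M) : S.ExtVanish (n + 1) X A := by
  induction n generalizing X with
  | zero =>
    obtain ⟨K, hK⟩ := hS.exists_syz X
    rw [extVanish_succ_iff hS hK, extVanish_zero_iff] at *
    obtain ⟨P, hP, i, p, ε, hε⟩ := hK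
    obtain ⟨x, y, δ, h⟩ := h
    intro θ
    obtain ⟨c, rfl⟩ := h.exists_pull θ (hM _)
    obtain ⟨b, rfl⟩ := hε.exists_desc c (hC _)
    rw [pull_comp, extVanish_zero_iff.1 (proj_iff.1 hP A) (pull S.E b δ), pull_zero]
  | succ n ih =>
    obtain ⟨K, hK⟩ := hS.exists_syz X
    rw [extVanish_succ_iff hS hK] at *
    exact ih hC hM

end Vanishing

/-! ### An extriangulated structure satisfies the axioms. -/

section Comparison

variable (hP : S.EnoughProjectives) (hI : S.EnoughInjectives)

/-- The relations between objects given by an extriangulated structure. -/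
def exactRel : ExactRel B where
  Tr := S.Tr
  V := S.ExtVanish
  tr_iso := Tr.iso
  tr_biprod := S.tr_biprod
  split := Tr.split
  et4 := by
    rintro A M D N F ⟨f, f', δ, h⟩ ⟨g, g', δ', h'⟩
    obtain ⟨Z, _, _, _, _, h₁, -, -, h₂, -⟩ := S.et4 h h'
    exact ⟨Z, h₁.tr, h₂.tr⟩
  et4_op := by
    rintro D A M F C ⟨f', f, δ, h⟩ ⟨g', g, δ', h'⟩
    obtain ⟨Z, _, _, _, _, h₁, -, -, h₂, -⟩ := S.et4_op h h'
    exact ⟨Z, h₁.tr, h₂.tr⟩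
  pushout := Tr.pushout
  pullback := Tr.pullback
  left_mid := Tr.left_mid hP
  left_fst := Tr.left_fst hP
  left_snd := Tr.left_snd hP
  right_mid := Tr.right_mid hP
  right_fst := Tr.right_fst hP
  right_snd := Tr.right_snd hP
  left_summand := extVanish_left_summand hP
  right_summand := extVanish_right_summand
  enough_proj X := by
    obtain ⟨K, P, x, y, hP', h⟩ := hP X
    exact ⟨K, P, ⟨x, y, h⟩, hP'.extVanish hP⟩
  enough_inj X := by
    obtain ⟨J, C, x, y, hJ, h⟩ := hI X
    exact ⟨J, C, ⟨x, y, h⟩, inj_iff.1 hJ⟩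

lemma exactRel_isProj_iff {P : B} : (S.exactRel hP hI).IsProj P ↔ S.proj P :=
  ⟨fun h => proj_iff.2 (h 0), fun h => h.extVanish hP⟩

lemma exactRel_isInj_iff {I : B} : (S.exactRel hP hI).IsInj I ↔ S.inj I := inj_iff.symm

lemma exactRel_veeN (T : ObjectProperty B) (n : ℕ) :
    (S.exactRel hP hI).veeN T n = S.veeN T n := by
  induction n with
  | zero => rfl
  | succ n ih =>
    ext X
    simp only [ExactRel.veeN, veeN, ih]
    constructor
    · rintro ⟨U, W, hU, hW, x, y, h⟩
      exact ⟨U, W, x, y, hU, hW, h⟩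
    · rintro ⟨U, W, x, y, hU, hW, h⟩
      exact ⟨U, W, hU, hW, x, y, h⟩

lemma exactRel_wedgeN (T : ObjectProperty B) (n : ℕ) :
    (S.exactRel hP hI).wedgeN T n = S.wedgeN T n := by
  unfold ExactRel.wedgeN
  induction n with
  | zero => rfl
  | succ n ih =>
    ext X
    simp only [ExactRel.veeN, wedgeN, ih]
    constructor
    · rintro ⟨U, W, hU, hW, x, y, h⟩
      exact ⟨W, U, x, y, hW, hU, h⟩
    · rintro ⟨W, U, x, y, hW, hU, h⟩
      exact ⟨U, W, hU, hW, x, y, h⟩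

lemma exactRel_vee (T : ObjectProperty B) : (S.exactRel hP hI).vee T = S.vee T := by
  ext X
  simp only [ExactRel.vee, vee, exactRel_veeN]

lemma exactRel_wedge (T : ObjectProperty B) : (S.exactRel hP hI).wedge T = S.wedge T := by
  ext X
  simp only [wedge, ← exactRel_wedgeN hP hI]
  rfl

lemma exactRel_cotorsion_iff {U W : ObjectProperty B} :
    (S.exactRel hP hI).Cotorsion U W ↔ S.IsCotorsionPair U W := by
  constructor
  · intro h
    refine ⟨h.left, h.right, fun X Y hX hY => extVanish_zero_iff.1 (h.ext X Y hX hY), ?_, ?_⟩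
    · intro X
      obtain ⟨Y, Z, hY, hZ, x, y, h⟩ := h.cone X
      exact ⟨Y, Z, x, y, hY, hZ, h⟩
    · intro X
      obtain ⟨Y, Z, hY, hZ, x, y, h⟩ := h.cocone X
      exact ⟨Y, Z, x, y, hY, hZ, h⟩
  · intro h
    refine ⟨h.left, h.right, fun X Y hX hY => extVanish_zero_iff.2 (h.ext_eq_zero X Y hX hY),
      ?_, ?_⟩
    · intro X
      obtain ⟨Y, Z, x, y, hY, hZ, h⟩ := h.cone X
      exact ⟨Y, Z, hY, hZ, x, y, h⟩
    · intro X
      obtain ⟨Y, Z, x, y, hY, hZ, h⟩ := h.cocone X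
      exact ⟨Y, Z, hY, hZ, x, y, h⟩

lemma IsGorenstein.exactRel (hG : S.IsGorenstein) : ∃ d, (S.exactRel hP hI).Gorenstein d := by
  obtain ⟨⟨m, hm⟩, n, hn⟩ := hG
  refine ⟨max m n, fun I hI' Y i hi => hm I ((exactRel_isInj_iff hP hI).1 hI') Y i ?_,
    fun P hP' Y i hi => hn P ((exactRel_isProj_iff hP hI).1 hP') Y i ?_⟩
  · exact (le_max_left m n).trans hi
  · exact (le_max_right m n).trans hi

/-- Self-extensions are required to vanish only up to degree `n`; beyond it the bound `pd T ≤ n`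
takes over. -/
lemma exactRel_preTilting_iff {T : ObjectProperty B} {n : ℕ} (hn : 1 ≤ n) :
    (S.exactRel hP hI).PreTilting n T ↔ S.IsPartialTiltingN n T :=
  ⟨fun h => ⟨hn, h.sub, h.pd, fun X Y hX hY i _ => h.ext X Y hX hY i⟩, fun h =>
    ⟨h.subcategory, h.pd_le, fun X Y hX hY i => (lt_or_ge i n).elim
      (h.ext_eq_zero X Y hX hY i) (h.pd_le X hX Y i)⟩⟩

lemma exactRel_dual_preTilting_iff {T : ObjectProperty B} {n : ℕ} (hn : 1 ≤ n) :
    (S.exactRel hP hI).dual.PreTilting n T ↔ S.IsPartialCotiltingN n T :=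
  ⟨fun h => ⟨hn, h.sub, h.pd, fun X Y hX hY i _ => h.ext Y X hY hX i⟩, fun h =>
    ⟨h.subcategory, h.id_le, fun X Y hX hY i => (lt_or_ge i n).elim
      (h.ext_eq_zero Y X hY hX i) (h.id_le X hX Y i)⟩⟩

end Comparison

theorem IsPartialTilting.tfae (hP : S.EnoughProjectives) (hI : S.EnoughInjectives)
    (hG : S.IsGorenstein) {T : ObjectProperty B} (hT : S.IsPartialTilting T) :
    [S.IsTilting T, S.IsCotorsionPair (S.vee T) (S.rightPerp T), S.IsCotilting T,
      S.IsCotorsionPair (S.leftPerp T) (S.wedge T)].TFAE := by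
  obtain ⟨n, hT⟩ := hT
  have hn := hT.one_le
  rw [← exactRel_preTilting_iff hP hI hn] at hT
  obtain ⟨d, hG⟩ := hG.exactRel hP hI
  have hT' := hT.dual hG
  -- The Gorenstein bound `d` may be zero, while cotilting requires a positive index. Likewise `max
  -- n d` below accommodates both `pd T ≤ n` and coresolutions of length `d`.
  have hd : (S.exactRel hP hI).dual.PreTilting (max d 1) T :=
    ⟨hT'.sub, fun X hX Y i hi => hT'.pd X hX Y i ((le_max_left d 1).trans hi), hT'.ext⟩
  have hnd : (S.exactRel hP hI).PreTilting (max n d) T :=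
    ⟨hT.sub, fun X hX Y i hi => hT.pd X hX Y i ((le_max_left n d).trans hi), hT.ext⟩
  have tilt {m : ℕ} (h : S.proj ≤ S.veeN T m) (P : B) (hP' : (S.exactRel hP hI).IsProj P) :
      (S.exactRel hP hI).vee T P :=
    ⟨m, (exactRel_veeN hP hI T m).symm ▸ h P ((exactRel_isProj_iff hP hI).1 hP')⟩
  have cotilt {m : ℕ} (h : S.inj ≤ S.wedgeN T m) (I : B)
      (hI' : (S.exactRel hP hI).dual.IsProj I) : (S.exactRel hP hI).dual.vee T I :=
    ⟨m, show (S.exactRel hP hI).wedgeN T m I from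
      (exactRel_wedgeN hP hI T m).symm ▸ h I ((exactRel_isInj_iff hP hI).1 hI')⟩
  rw [← exactRel_cotorsion_iff hP hI, ← exactRel_cotorsion_iff hP hI, ← exactRel_vee hP hI,
    ← exactRel_wedge hP hI]
  tfae_have 1 → 2 := fun ⟨m, _, h⟩ => hT.cotorsion (tilt h) hG
  tfae_have 2 → 1 := fun h => ⟨n, (exactRel_preTilting_iff hP hI hn).1 hT, fun P hP' =>
    exactRel_veeN hP hI T n ▸ hT.isProj_veeN h ((exactRel_isProj_iff hP hI).2 hP')⟩
  tfae_have 3 → 4 := fun ⟨m, _, h⟩ =>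
    ExactRel.Cotorsion.dual_iff.1 (hT'.cotorsion (cotilt h) hG.dual)
  tfae_have 4 → 3 := fun h => ⟨max d 1,
    (exactRel_dual_preTilting_iff hP hI (le_max_right d 1)).1 hd, fun I hI' =>
    exactRel_wedgeN hP hI T _ ▸ hd.isProj_veeN (ExactRel.Cotorsion.dual_iff.2 h)
      ((exactRel_isInj_iff hP hI).2 hI')⟩
  tfae_have 1 → 3 := fun ⟨m, _, h⟩ => ⟨max d 1,
    (exactRel_dual_preTilting_iff hP hI (le_max_right d 1)).1 hd, fun I hI' =>
    exactRel_wedgeN hP hI T _ ▸ ExactRel.veeN_mono hT.sub (le_max_left d 1)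
      (hT.isInj_wedgeN (tilt h) hG ((exactRel_isInj_iff hP hI).2 hI'))⟩
  tfae_have 3 → 1 := fun ⟨m, _, h⟩ => ⟨max n d,
    (exactRel_preTilting_iff hP hI (hn.trans (le_max_left n d))).1 hnd, fun P hP' =>
    exactRel_veeN hP hI T _ ▸ ExactRel.veeN_mono hT.sub (le_max_right n d)
      (hT'.isInj_wedgeN (cotilt h) hG.dual ((exactRel_isProj_iff hP hI).2 hP'))⟩
  tfae_finish

end Structure

end Extri

theorem lemma5p8 {k : Type*} [Field k] {B : Type u} [Category.{v} B] [Preadditive B]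
    [Linear k B] [HasZeroObject B] [HasBinaryBiproducts B] (S : Extri.Structure.{w} B)
    (hKS : Extri.KrullSchmidt B) (hHom : Extri.HomFinite k B)
    (hP : S.EnoughProjectives) (hI : S.EnoughInjectives) (hWIC : S.WIC)
    (hAF : S.AF) (hG : S.IsGorenstein) :
    (∀ T : ObjectProperty B, S.IsPartialTilting T →
      [S.IsTilting T,
        S.IsCotorsionPair (S.vee T) (S.rightPerp T),
        S.IsCotilting T,
        S.IsCotorsionPair (S.leftPerp T) (S.wedge T)].TFAE) ∧
    (∀ T : ObjectProperty B, S.IsTilting T → S.CP T) := by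
  refine ⟨fun T hT => hT.tfae hP hI hG, fun T hT => ?_⟩
  have hT' : S.IsPartialTilting T := hT.imp fun _ h => h.1
  exact ⟨((hT'.tfae hP hI hG).out 0 1).1 hT, ((hT'.tfae hP hI hG).out 0 3).1 hT⟩
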